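/- All graphs are finite and have no loops. A plane graph $G$ has as vertices finitely many points of $\mathbb{R}^2$ and as edges simple arcs, each joining two distinct vertices; an edge contains no vertex other than its two ends, and two different edges meet only in common end vertices. Its faces are the connected components of the complement in $\mathbb{R}^2$ of the union of its vertices and edges; a vertex is incident with a face if it lies on the boundary of that face. The degree of a face is the number of vertices incident with it, and $\Delta^*(G)$ denotes the maximum face degree of $G$. A cyclic coloring of $G$ is a coloring of its vertices in which any two different vertices incident with the same face receive different colors; $\chi_c(G)$ is the minimum number of colors in a cyclic coloring of $G$. Let $t(G)$ be the number of vertices of a longest path in $G$ all of whose vertices have degree $2$ in $G$ ($t(G)=0$ if there is no vertex of degree $2$). Subdividing an edge $uv$ of a plane graph means placing a new vertex $w$ in the interior of that arc, so that the edge is replaced by a path $u,w,v$; a subdivision of a plane graph $R$ is a plane graph obtained from $R$ by a finite, possibly empty, sequence of subdivisions of edges. A graph is $3$-connected if it has at least four vertices and remains connected after the removal of any at most two vertices. **Corollary.** Let $R$ be a simple $3$-connected plane graph and let $G$ be a subdivision of $R$. If $$\Delta^*(G) \ge 2\chi_c(R) + 2t(G) - 6,$$ then $$\chi_c(G) \le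 \left\lfloor \tfrac{3}{2}\Delta^*(G) \right\rfloor .$$ -/

import Mathlib

/-- The Euclidean plane. -/
abbrev Plane : Type := EuclideanSpace ℝ (Fin 2)

/-- `A` is a simple arc in the plane with end points `x` and `y` (so `x ≠ y`). -/
def IsArc (x y : Plane) (A : Set Plane) : Prop :=
  ∃ γ : unitInterval → Plane,
    Continuous γ ∧ Function.Injective γ ∧ γ 0 = x ∧ γ 1 = y ∧ Set.range γ = A

/-- A finite plane graph without loops; multiple edges are allowed. The vertices are points of
the plane and every edge is a simple arc joining two vertices. An edge contains no vertices
besides its two ends, and two different edges meet only in vertices. -/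
structure PlaneGraph where
  verts : Set Plane
  edges : Set (Set Plane)
  finite_verts : verts.Finite
  finite_edges : edges.Finite
  isArc_of_mem : ∀ e ∈ edges, ∃ x ∈ verts, ∃ y ∈ verts, IsArc x y e ∧ e ∩ verts = {x, y}
  inter_subset : ∀ e ∈ edges, ∀ e' ∈ edges, e ≠ e' → e ∩ e' ⊆ verts

namespace PlaneGraph

/-- The set of points of the plane covered by the vertices and edges. -/
def support (G : PlaneGraph) : Set Plane := G.verts ∪ ⋃₀ G.edges

/-- The faces: the connected components of the complement of the drawing. -/
def faces (G : PlaneGraph) : Set (Set Plane) :=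
  {f | ∃ x ∈ G.supportᶜ, f = connectedComponentIn G.supportᶜ x}

/-- The set of vertices incident with a face `f`: those on the boundary of `f`. -/
def faceVerts (G : PlaneGraph) (f : Set Plane) : Set Plane := G.verts ∩ frontier f

/-- The degree of a face: the number of vertices incident with it. -/
noncomputable def faceDegree (G : PlaneGraph) (f : Set Plane) : ℕ := (G.faceVerts f).ncard

/-- The maximum face degree. -/
noncomputable def maxFaceDegree (G : PlaneGraph) : ℕ :=
  sSup {n : ℕ | ∃ f ∈ G.faces, G.faceDegree f = n}

/-- The degree of a vertex: the number of edges incident with it. -/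
noncomputable def degree (G : PlaneGraph) (v : Plane) : ℕ := {e ∈ G.edges | v ∈ e}.ncard

/-- The adjacency relation on the vertices. -/
def graph (G : PlaneGraph) : SimpleGraph G.verts where
  Adj u v := u ≠ v ∧ ∃ e ∈ G.edges, (u : Plane) ∈ e ∧ (v : Plane) ∈ e
  symm := ⟨fun _ _ ⟨h, e, he, hu, hv⟩ => ⟨h.symm, e, he, hv, hu⟩⟩
  loopless := ⟨fun _ h => h.1 rfl⟩

/-- A plane graph is simple if different edges have different pairs of ends. -/
def IsSimple (G : PlaneGraph) : Prop :=
  ∀ e ∈ G.edges, ∀ e' ∈ G.edges, e ∩ G.verts = e' ∩ G.verts → e = e'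

/-- A graph is 3-connected if it has at least four vertices and stays connected after the
removal of any set of at most two vertices. -/
def IsThreeConnected (G : PlaneGraph) : Prop :=
  4 ≤ G.verts.ncard ∧ ∀ S : Set G.verts, S.ncard ≤ 2 → (G.graph.induce Sᶜ).Connected

/-- A cyclic coloring: different vertices incident with a common face get different colors. -/
def IsCyclicColoring (G : PlaneGraph) {C : Type} (c : G.verts → C) : Prop :=
  ∀ f ∈ G.faces, ∀ u v : G.verts, (u : Plane) ∈ G.faceVerts f → (v : Plane) ∈ G.faceVerts f →
    u ≠ v → c u ≠ c v

/-- The cyclic chromatic number: the least number of colors in a cyclic coloring. -/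
noncomputable def cyclicChromaticNumber (G : PlaneGraph) : ℕ :=
  sInf {k : ℕ | ∃ c : G.verts → Fin k, G.IsCyclicColoring c}

/-- The number of vertices of a longest path all of whose vertices have degree two
(zero if there is no vertex of degree two). -/
noncomputable def longestTwoPath (G : PlaneGraph) : ℕ :=
  sSup {n : ℕ | ∃ (u v : G.verts) (p : G.graph.Walk u v),
    p.IsPath ∧ (∀ w ∈ p.support, G.degree w = 2) ∧ p.support.length = n}

/-- `G` arises from `R` by subdividing one edge `e`: a new vertex `w` is placed on `e`, which is
thereby replaced by its two subarcs, from one end `u` to `w` and from `w` to the other end `v`. -/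
def IsEdgeSubdivision (R G : PlaneGraph) : Prop :=
  ∃ e ∈ R.edges, ∃ u ∈ R.verts, ∃ v ∈ R.verts, ∃ w ∉ R.verts, ∃ e₁ e₂ : Set Plane,
    IsArc u w e₁ ∧ IsArc w v e₂ ∧ e₁ ∪ e₂ = e ∧ e₁ ∩ e₂ = {w} ∧
    G.verts = insert w R.verts ∧ G.edges = (R.edges \ {e}) ∪ {e₁, e₂}

/-- `G` is a subdivision of `R`: it arises by a finite (possibly empty) sequence of edge
subdivisions. -/
def IsSubdivision (R G : PlaneGraph) : Prop := Relation.ReflTransGen IsEdgeSubdivision R G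

end PlaneGraph

/-! The vertices of `R` and the subdivision vertices get disjoint palettes. The old vertices take an
optimal cyclic coloring of `R`. A subdivision vertex lies inside an edge of `R` and is therefore
incident with at most two faces; it is read as an edge of a dual multigraph joining those faces, and
a proper edge coloring of this multigraph is exactly what a cyclic coloring of the new vertices
requires.

Every face of `R` is incident with at least three vertices of `R`, so a dual vertex has degree at
most Δ* - 3. Two different faces of a 3-connected `R` share at most one edge, so parallel dual edges
come from a single edge of `R`, whose new vertices form a path of vertices of degree two; the
multiplicity is at most t. Vizing's theorem for multigraphs then needs Δ* - 3 + t new colors. The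
hypothesis says that χ_c(R) + t - 3 is at most Δ*/2, which gives the bound.

The topology rests on Eilenberg's criterion: a compact set `K` fails to separate `a` from `b`
exactly when (z - a)/(z - b) has a continuous logarithm on `K` (`hasLogOn_quot_of_mem`,
`mem_of_hasLogOn_quot`). Gluing logarithms along a connected intersection (`HasLogOn.union`) plays
the role of Janiszewski's theorem. From this come `eq_of_mem_frontier_three` (at most two faces at
an inner point of an edge), `eq_of_mem_frontier_two` (at most one common edge) and
`three_le_faceDegree`. The combinatorial half is `EdgeColoring.exists_proper`, and `Refines` records
what a subdivision preserves. -/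

section

open Set Filter Topology

/-! ### Continuous logarithms and separation in the plane. -/

namespace PlaneLog

/-- A continuous function on a preconnected set whose exponential is constant is constant. -/
theorem eq_of_exp_const {X : Type*} [TopologicalSpace X] {S : Set X} (hS : IsPreconnected S)
    {g : X → ℂ} (hg : ContinuousOn g S) {c : ℂ} (hc : ∀ x ∈ S, Complex.exp (g x) = c)
    {x y : X} (hx : x ∈ S) (hy : y ∈ S) : g x = g y := by
  refine Complex.isCoveringMap_exp.constOn_of_comp hS hg ?_ hx hy
  intro a ha b hb
  exact Subtype.ext ((hc a ha).trans (hc b hb).symm)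

/-- This is the lifting criterion for the covering of the punctured plane by `Complex.exp`. It is
applied to the real line and to the complex plane. -/
theorem exists_continuous_log {X : Type*} [TopologicalSpace X] [SimplyConnectedSpace X]
    [LocallyPathConnectedSpace X] {f : X → ℂ} (hf : Continuous f) (h0 : ∀ x, f x ≠ 0) :
    ∃ g : X → ℂ, Continuous g ∧ ∀ x, Complex.exp (g x) = f x := by
  obtain ⟨x₀⟩ : Nonempty X := inferInstance
  obtain ⟨g, ⟨-, hg⟩, -⟩ := Complex.isCoveringMapOn_exp.existsUnique_continuousMap_lifts
    ⟨f, hf⟩ (Complex.exp_log (h0 x₀)) h0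
  exact ⟨g, g.continuous, congrFun hg⟩

/-- A nonvanishing continuous function on the complex plane agreeing with `(z - p) ^ n` near
infinity has `n = 0`. -/
theorem zpow_eq_zero_of_nonvanishing {F : ℂ → ℂ} (hF : Continuous F) (h0 : ∀ z, F z ≠ 0)
    {p : ℂ} {n : ℤ} {r : ℝ} (hr : ∀ z, r < ‖z - p‖ → F z = (z - p) ^ n) : n = 0 := by
  obtain ⟨G, hG, hGF⟩ := exists_continuous_log hF h0
  set R : ℝ := |r| + 1 with hR
  have hR0 : 0 < R := by positivity
  let z : ℝ → ℂ := fun θ => p + R * Complex.exp (θ * Complex.I)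
  have hz : Continuous z := by fun_prop
  have hzF : ∀ θ, F (z θ) = (R * Complex.exp (θ * Complex.I)) ^ n := by
    intro θ
    have : z θ - p = R * Complex.exp (θ * Complex.I) := by simp [z]
    rw [← this]
    apply hr
    rw [this, norm_mul, Complex.norm_exp_ofReal_mul_I, Complex.norm_real, Real.norm_eq_abs,
      abs_of_pos hR0, mul_one]
    linarith [le_abs_self r]
  -- A winding number argument: along the circle the logarithm of `F` grows like `n * θ * I`, yet it
  -- must return to its initial value after one turn.
  have key := eq_of_exp_const (S := (univ : Set ℝ)) isPreconnected_univ
    (g := fun θ => G (z θ) - n * (θ * Complex.I)) (c := (R : ℂ) ^ n)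
    (by fun_prop) (by
      intro θ _
      rw [Complex.exp_sub, hGF, hzF, mul_zpow, ← Complex.exp_int_mul, mul_div_assoc,
        div_self (Complex.exp_ne_zero _), mul_one])
    (mem_univ 0) (mem_univ (2 * Real.pi))
  have hz2 : z (2 * Real.pi) = z 0 := by
    simp [z, Complex.exp_two_pi_mul_I]
  simp only [hz2] at key
  have : (n : ℂ) * (2 * Real.pi * Complex.I) = 0 := by
    push_cast at key
    linear_combination key
  have h2 := Complex.two_pi_I_ne_zero
  rcases mul_eq_zero.1 this with h | h
  · exact_mod_cast h
  · exact absurd h h2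

/-- The identification of the plane with the complex numbers. -/
noncomputable def coord : Plane ≃ₗᵢ[ℝ] ℂ := Complex.orthonormalBasisOneI.repr.symm

theorem continuous_coord : Continuous coord := coord.continuous

theorem coord_sub_ne_zero {a b : Plane} (h : a ≠ b) : coord a - coord b ≠ 0 :=
  sub_ne_zero.2 fun h' => h (coord.injective h')

/-- `f` has a continuous logarithm on `K`. -/
def HasLogOn (f : Plane → ℂ) (K : Set Plane) : Prop :=
  ∃ g : Plane → ℂ, ContinuousOn g K ∧ ∀ z ∈ K, Complex.exp (g z) = f z

/-- The quotient of the distance vectors to `a` and to `b`. -/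
noncomputable def quot (a b : Plane) (z : Plane) : ℂ :=
  (coord z - coord a) / (coord z - coord b)

theorem HasLogOn.mono {f : Plane → ℂ} {K L : Set Plane} (h : HasLogOn f L) (hKL : K ⊆ L) :
    HasLogOn f K := by
  obtain ⟨g, hg, he⟩ := h
  exact ⟨g, hg.mono hKL, fun z hz => he z (hKL hz)⟩

theorem HasLogOn.congr {f f' : Plane → ℂ} {K : Set Plane} (h : HasLogOn f K)
    (hf : ∀ z ∈ K, f z = f' z) : HasLogOn f' K := by
  obtain ⟨g, hg, he⟩ := h
  exact ⟨g, hg, fun z hz => (he z hz).trans (hf z hz)⟩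

theorem HasLogOn.mul {f f' : Plane → ℂ} {K : Set Plane} (h : HasLogOn f K) (h' : HasLogOn f' K) :
    HasLogOn (fun z => f z * f' z) K := by
  obtain ⟨g, hg, he⟩ := h
  obtain ⟨g', hg', he'⟩ := h'
  exact ⟨fun z => g z + g' z, hg.add hg', fun z hz => by rw [Complex.exp_add, he z hz, he' z hz]⟩

theorem HasLogOn.inv {f : Plane → ℂ} {K : Set Plane} (h : HasLogOn f K) :
    HasLogOn (fun z => (f z)⁻¹) K := by
  obtain ⟨g, hg, he⟩ := h
  exact ⟨fun z => -g z, hg.neg, fun z hz => by rw [Complex.exp_neg, he z hz]⟩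

theorem quot_mul_quot {a b c z : Plane} (hz : z ≠ b) :
    quot a b z * quot b c z = quot a c z := by
  have := coord_sub_ne_zero hz
  simp only [quot]
  rw [div_mul_div_cancel₀ this]

theorem inv_quot (a b z : Plane) : (quot a b z)⁻¹ = quot b a z := by
  simp [quot]

theorem quot_ne_zero {a b z : Plane} (ha : z ≠ a) (hb : z ≠ b) : quot a b z ≠ 0 :=
  div_ne_zero (coord_sub_ne_zero ha) (coord_sub_ne_zero hb)

theorem continuousAt_quot {a b z : Plane} (hb : z ≠ b) : ContinuousAt (quot a b) z := by
  have := coord_sub_ne_zero hb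
  have hc := continuous_coord
  exact ContinuousAt.div (by fun_prop) (by fun_prop) this

/-- Two points of the same component of the complement of `K` are not separated by logarithms. -/
theorem hasLogOn_quot_of_mem {K : Set Plane} (hK : IsClosed K) {S : Set Plane}
    (hS : IsPreconnected S) (hSK : S ⊆ Kᶜ) {a b : Plane} (ha : a ∈ S) (hb : b ∈ S) :
    HasLogOn (quot a b) K := by
  -- On a connected set it is enough that the relation holds locally in both orders and is
  -- transitive.
  refine hS.induction₂' (fun x y => x ∈ S → y ∈ S → HasLogOn (quot x y) K) ?_ ?_ ha hb ha hb
  · intro x hx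
    obtain ⟨r, hr, hrK⟩ := Metric.isOpen_iff.1 hK.isOpen_compl x (hSK hx)
    have key : ∀ y ∈ Metric.ball x (r / 3), HasLogOn (quot x y) K := by
      intro y hy
      have hyx : dist y x < r / 3 := hy
      have hfar : ∀ z ∈ K, r ≤ dist z x := by
        intro z hz
        by_contra h
        exact hrK (show z ∈ Metric.ball x r from not_le.1 h) hz
      have hzy : ∀ z ∈ K, 2 * r / 3 < dist z y := by
        intro z hz
        have h1 := hfar z hz
        have h2 := dist_triangle z y x
        linarith
      -- `y` is within `r / 3` of `x`, while points of `K` are more than `2 * r / 3` away from `y`.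
      -- So the quotient lies in the unit disc about 1, where the principal branch is continuous.
      have hslit : ∀ z ∈ K, quot x y z ∈ Complex.slitPlane := by
        intro z hz
        have hne : z ≠ y := by
          rintro rfl
          have := hzy z hz
          rw [dist_self] at this
          linarith
        have h0 := coord_sub_ne_zero hne
        have he : quot x y z = 1 + (coord y - coord x) / (coord z - coord y) := by
          simp only [quot]
          field_simp
          ring
        rw [he]
        apply Complex.mem_slitPlane_of_norm_lt_one
        rw [norm_div, ← map_sub, ← map_sub, coord.norm_map, coord.norm_map, ← dist_eq_norm,
          ← dist_eq_norm]
        have := hzy z hz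
        rw [div_lt_one (by linarith)]
        linarith
      refine ⟨fun z => Complex.log (quot x y z), ?_, ?_⟩
      · intro z hz
        have hne : z ≠ y := by
          rintro rfl
          have := hzy z hz
          rw [dist_self] at this
          linarith
        exact ((continuousAt_quot hne).clog (hslit z hz)).continuousWithinAt
      · intro z hz
        exact Complex.exp_log (Complex.slitPlane_ne_zero (hslit z hz))
    filter_upwards [mem_nhdsWithin_of_mem_nhds (Metric.ball_mem_nhds x (by linarith : 0 < r / 3))]
      with y hy
    refine ⟨fun _ _ => key y hy, fun _ _ => ?_⟩
    simpa only [inv_quot] using (key y hy).inv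
  · intro x y z hx hy hz h1 h2 _ _
    refine ((h1 hx hy).mul (h2 hy hz)).congr fun w hw => quot_mul_quot ?_
    rintro rfl
    exact hSK hy hw

/-- The strong separation criterion. -/
theorem exponent_eq_zero {K : Set Plane} (hK : IsClosed K) {a b c : Plane} {k l m : ℤ}
    (ha : a ∉ K) (hb : b ∉ K) (hc : c ∉ K)
    (hbd : Bornology.IsBounded (connectedComponentIn Kᶜ a))
    (hab : b ∉ connectedComponentIn Kᶜ a) (hac : c ∉ connectedComponentIn Kᶜ a)
    (h : HasLogOn (fun z => (coord z - coord a) ^ k * (coord z - coord b) ^ l *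
      (coord z - coord c) ^ m) K) : k = 0 := by
  set U := connectedComponentIn Kᶜ a with hU
  have hUo : IsOpen U := hK.isOpen_compl.connectedComponentIn
  have hUK : U ⊆ Kᶜ := connectedComponentIn_subset _ _
  have haU : a ∈ U := mem_connectedComponentIn ha
  have hclU : closure U ⊆ U ∪ K := by
    intro z hz
    by_contra hzn
    simp only [mem_union, not_or] at hzn
    have hpre : IsPreconnected (insert z U) :=
      isPreconnected_connectedComponentIn.subset_closure (subset_insert _ _)
        (insert_subset hz subset_closure)
    have := hpre.subset_connectedComponentIn (mem_insert_of_mem _ haU)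
      (insert_subset hzn.2 hUK)
    exact hzn.1 (this (mem_insert _ _))
  obtain ⟨g, hg, hgE⟩ := h
  -- Tietze extension of the logarithm to the whole plane.
  obtain ⟨g', hg'⟩ := ContinuousMap.exists_restrict_eq (Y := ℂ) hK ⟨K.domRestrict g, hg.domRestrict⟩
  have hg'K : ∀ z ∈ K, g' z = g z := fun z hz => by
    simpa using DFunLike.congr_fun hg' (⟨z, hz⟩ : K)
  have hbne : ∀ z ∈ closure U, z ≠ b := by
    rintro z hz rfl
    exact (hclU hz).elim hab hb
  have hcne : ∀ z ∈ closure U, z ≠ c := by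
    rintro z hz rfl
    exact (hclU hz).elim hac hc
  classical
  let A : Plane → ℂ := fun z =>
    Complex.exp (g' z) * (coord z - coord b) ^ (-l) * (coord z - coord c) ^ (-m)
  let B : Plane → ℂ := fun z => (coord z - coord a) ^ k
  -- The two formulas agree on the frontier of `U`, which lies in `K`. `A` has no zero or pole on
  -- `U` since `b` and `c` lie outside, and `B` has none off `U` since `a` lies inside. As `U` is
  -- bounded, `F` is a nonvanishing function equal to the `k`-th power near infinity.
  let F : Plane → ℂ := U.piecewise A B
  have hcc := continuous_coord
  have hF : Continuous F := by
    apply continuous_piecewise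
    · intro z hz
      have hzK : z ∈ K := by
        rcases hclU (frontier_subset_closure hz) with h | h
        · exact absurd h (by simpa [hUo.interior_eq] using hz.2)
        · exact h
      have h1 := hgE z hzK
      have hb' := coord_sub_ne_zero (hbne z (frontier_subset_closure hz))
      have hc' := coord_sub_ne_zero (hcne z (frontier_subset_closure hz))
      simp only [A, B, hg'K z hzK, h1, zpow_neg]
      have := zpow_ne_zero l hb'
      have := zpow_ne_zero m hc'
      field_simp
    · intro z hz
      have hb' := coord_sub_ne_zero (hbne z hz)
      have hc' := coord_sub_ne_zero (hcne z hz)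
      have : ContinuousAt A z := by
        refine ContinuousAt.mul (ContinuousAt.mul ?_ ?_) ?_
        · exact (Complex.continuous_exp.comp g'.continuous).continuousAt
        · exact ContinuousAt.zpow₀ (by fun_prop) _ (Or.inl hb')
        · exact ContinuousAt.zpow₀ (by fun_prop) _ (Or.inl hc')
      exact this.continuousWithinAt
    · intro z hz
      have hza : z ≠ a := by
        rintro rfl
        rw [hUo.isClosed_compl.closure_eq] at hz
        exact hz haU
      have ha' := coord_sub_ne_zero hza
      have : ContinuousAt B z := ContinuousAt.zpow₀ (by fun_prop) _ (Or.inl ha')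
      exact this.continuousWithinAt
  have hF0 : ∀ z, F z ≠ 0 := by
    intro z
    by_cases hz : z ∈ U
    · have hb' := coord_sub_ne_zero (hbne z (subset_closure hz))
      have hc' := coord_sub_ne_zero (hcne z (subset_closure hz))
      simp only [F, piecewise_eq_of_mem _ _ _ hz, A]
      exact mul_ne_zero (mul_ne_zero (Complex.exp_ne_zero _) (zpow_ne_zero _ hb'))
        (zpow_ne_zero _ hc')
    · have hza : z ≠ a := by
        rintro rfl
        exact hz haU
      simp only [F, piecewise_eq_of_notMem _ _ _ hz, B]
      exact zpow_ne_zero _ (coord_sub_ne_zero hza)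
  obtain ⟨r, hr⟩ := hbd.subset_closedBall a
  refine zpow_eq_zero_of_nonvanishing (F := F ∘ coord.symm) (hF.comp coord.symm.continuous)
    (fun z => hF0 _) (p := coord a) (r := r) ?_
  intro z hz
  have : coord.symm z ∉ U := by
    intro h
    have h1 := hr h
    rw [Metric.mem_closedBall, ← coord.dist_map, coord.apply_symm_apply, dist_eq_norm] at h1
    linarith
  simp [F, piecewise_eq_of_notMem _ _ _ this, B]

/-- The complement of a bounded set has at most one unbounded component. -/
theorem isBounded_or_isBounded {K : Set Plane} (hK : Bornology.IsBounded K) {a b : Plane}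
    (h : b ∉ connectedComponentIn Kᶜ a) (hb : b ∉ K) :
    Bornology.IsBounded (connectedComponentIn Kᶜ a) ∨
      Bornology.IsBounded (connectedComponentIn Kᶜ b) := by
  obtain ⟨r, hr⟩ := hK.subset_closedBall 0
  by_contra! hcon
  obtain ⟨h1, h2⟩ := hcon
  -- A nonnegative radius keeps every point outside the ball away from the origin, so that polar
  -- coordinates present the exterior as a product of connected sets.
  set r' := max r 0
  have hO : IsPreconnected ((Metric.closedBall (0 : Plane) r')ᶜ) := by
    have : (Metric.closedBall (0 : Plane) r')ᶜ =
        (fun q : ℝ × Plane => q.1 • q.2) '' (Ioi r' ×ˢ Metric.sphere 0 1) := by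
      ext z
      simp only [mem_compl_iff, Metric.mem_closedBall, dist_zero_right, not_le, mem_image,
        mem_prod, mem_Ioi, Metric.mem_sphere, Prod.exists]
      constructor
      · intro hz
        have : 0 < ‖z‖ := lt_of_le_of_lt (le_max_right _ _) hz
        refine ⟨‖z‖, ‖z‖⁻¹ • z, ⟨hz, ?_⟩, ?_⟩
        · rw [norm_smul, norm_inv, norm_norm, inv_mul_cancel₀ this.ne']
        · rw [smul_smul, mul_inv_cancel₀ this.ne', one_smul]
      · rintro ⟨s, w, ⟨hs, hw⟩, rfl⟩
        rw [norm_smul, hw, mul_one, Real.norm_eq_abs]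
        exact lt_of_lt_of_le hs (le_abs_self s)
    rw [this]
    refine IsPreconnected.image (isPreconnected_Ioi.prod ?_) _ (by fun_prop)
    exact isPreconnected_sphere (by
      rw [← Module.finrank_eq_rank]
      simp) _ _
  have hOK : (Metric.closedBall (0 : Plane) r')ᶜ ⊆ Kᶜ :=
    compl_subset_compl.2 (hr.trans (Metric.closedBall_subset_closedBall (le_max_left _ _)))
  have hmeet : ∀ V : Set Plane, ¬ Bornology.IsBounded V →
      ∃ x ∈ V, x ∈ (Metric.closedBall (0 : Plane) r')ᶜ := by
    intro V hV
    by_contra! hcon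
    exact hV (Metric.isBounded_closedBall.subset fun x hx => not_not.1 (hcon x hx))
  obtain ⟨x, hx, hxO⟩ := hmeet _ h1
  obtain ⟨y, hy, hyO⟩ := hmeet _ h2
  have h3 := hO.subset_connectedComponentIn hxO hOK hyO
  rw [connectedComponentIn_eq hx, connectedComponentIn_eq h3, ← connectedComponentIn_eq hy] at h
  exact h (mem_connectedComponentIn hb)

theorem hasLogOn_zpow_of_quot {K : Set Plane} {a b : Plane} (h : HasLogOn (quot a b) K) :
    HasLogOn (fun z => (coord z - coord a) ^ (1 : ℤ) * (coord z - coord b) ^ (-1 : ℤ) *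
      (coord z - coord b) ^ (0 : ℤ)) K :=
  h.congr fun z _ => by simp [quot, div_eq_mul_inv]

/-- Points not separated by logarithms lie in the same component of the complement. -/
theorem mem_of_hasLogOn_quot {K : Set Plane} (hK : IsCompact K) {a b : Plane} (ha : a ∉ K)
    (hb : b ∉ K) (h : HasLogOn (quot a b) K) : b ∈ connectedComponentIn Kᶜ a := by
  by_contra hab
  have hba : a ∉ connectedComponentIn Kᶜ b := by
    intro h'
    exact hab (by rw [← connectedComponentIn_eq h']; exact mem_connectedComponentIn hb)
  -- At least one of the two components is bounded; the criterion at that point forces its exponent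
  -- 1 to vanish.
  rcases isBounded_or_isBounded hK.isBounded hab hb with hbd | hbd
  · exact one_ne_zero (exponent_eq_zero hK.isClosed ha hb hb hbd hab hab (hasLogOn_zpow_of_quot h))
  · have h' : HasLogOn (quot b a) K := by simpa only [inv_quot] using h.inv
    exact one_ne_zero (exponent_eq_zero hK.isClosed hb ha ha hbd hba hba (hasLogOn_zpow_of_quot h'))

/-- Logarithms differing by a constant on the intersection can be glued. -/
theorem hasLogOn_union {f : Plane → ℂ} {A B : Set Plane} (hA : IsClosed A) (hB : IsClosed B)
    {g h : Plane → ℂ} (hg : ContinuousOn g A) (hgE : ∀ z ∈ A, Complex.exp (g z) = f z)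
    (hh : ContinuousOn h B) (hhE : ∀ z ∈ B, Complex.exp (h z) = f z)
    (hAB : ∀ x ∈ A ∩ B, ∀ y ∈ A ∩ B, g x - h x = g y - h y) : HasLogOn f (A ∪ B) := by
  classical
  obtain ⟨c, hc1, hc⟩ : ∃ c, Complex.exp c = 1 ∧ ∀ x ∈ A ∩ B, g x = h x + c := by
    by_cases hne : (A ∩ B).Nonempty
    · obtain ⟨y, hy⟩ := hne
      refine ⟨g y - h y, ?_, fun x hx => by rw [← hAB x hx y hy]; ring⟩
      rw [Complex.exp_sub, hgE y hy.1, hhE y hy.2, div_self]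
      rw [← hgE y hy.1]
      exact Complex.exp_ne_zero _
    · exact ⟨0, Complex.exp_zero, fun x hx => absurd ⟨x, hx⟩ hne⟩
  refine ⟨A.piecewise g (fun z => h z + c), ?_, ?_⟩
  · refine ContinuousOn.union_of_isClosed ?_ ?_ hA hB
    · exact hg.congr fun z hz => piecewise_eq_of_mem _ _ _ hz
    · refine (hh.add (continuousOn_const (c := c))).congr fun z hz => ?_
      by_cases hzA : z ∈ A
      · rw [piecewise_eq_of_mem _ _ _ hzA, hc z ⟨hzA, hz⟩, Pi.add_apply]
      · rw [piecewise_eq_of_notMem _ _ _ hzA, Pi.add_apply]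
  · intro z hz
    by_cases hzA : z ∈ A
    · rw [piecewise_eq_of_mem _ _ _ hzA, hgE z hzA]
    · rw [piecewise_eq_of_notMem _ _ _ hzA, Complex.exp_add, hc1, mul_one,
        hhE z (hz.resolve_left hzA)]

/-- Two logarithms differ by a function with exponential 1, hence by a constant on a connected
intersection. With the separation criterion this is Janiszewski's theorem: two compact sets with
connected intersection, neither separating two points, do not separate them together. -/
theorem HasLogOn.union {f : Plane → ℂ} {A B : Set Plane} (hA : IsClosed A) (hB : IsClosed B)
    (h1 : HasLogOn f A) (h2 : HasLogOn f B) (hAB : IsPreconnected (A ∩ B)) :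
    HasLogOn f (A ∪ B) := by
  obtain ⟨g, hg, hgE⟩ := h1
  obtain ⟨h, hh, hhE⟩ := h2
  refine hasLogOn_union hA hB hg hgE hh hhE fun x hx y hy => ?_
  refine eq_of_exp_const (g := fun z => g z - h z) (c := 1) hAB
    ((hg.mono inter_subset_left).sub (hh.mono inter_subset_right)) (fun z hz => ?_) hx hy
  rw [Complex.exp_sub, hgE z hz.1, hhE z hz.2, div_self]
  rw [← hgE z hz.1]
  exact Complex.exp_ne_zero _

/-- A nonvanishing continuous function has a logarithm on a subarc. -/
theorem hasLogOn_image_Icc {γ : unitInterval → Plane} (hγ : Continuous γ)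
    (hinj : Function.Injective γ) (s t : unitInterval) {f : Plane → ℂ}
    (hf : ∀ z ∈ γ '' Icc s t, ContinuousAt f z) (h0 : ∀ z ∈ γ '' Icc s t, f z ≠ 0) :
    HasLogOn f (γ '' Icc s t) := by
  -- The degenerate case matters: `exists_subarc` assigns an empty subarc to an edge that misses the
  -- closed set.
  rcases lt_or_ge t s with hts | hst
  · rw [Icc_eq_empty (not_le.2 hts), image_empty]
    exact ⟨fun _ => 0, continuousOn_empty _, by simp⟩
  have hcl : IsClosedEmbedding γ := hγ.isClosedEmbedding hinj
  -- Clamping the real line to `[s, t]` makes the pullback of `f` a nonvanishing function on a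
  -- simply connected space.
  let q : ℝ → unitInterval := fun x => projIcc s t hst (projIcc 0 1 zero_le_one x)
  have hq : Continuous q := by
    have h1 : Continuous (projIcc (0 : ℝ) 1 zero_le_one) := continuous_projIcc
    have h2 : Continuous (projIcc s t hst) := continuous_projIcc
    exact continuous_subtype_val.comp (h2.comp h1)
  have hqm : ∀ x, γ (q x) ∈ γ '' Icc s t := fun x => mem_image_of_mem _ (projIcc s t hst _).2
  have hc : Continuous fun x => f (γ (q x)) := by
    rw [continuous_iff_continuousAt]
    intro x
    exact ContinuousAt.comp (f := fun x => γ (q x)) (hf _ (hqm x)) (hγ.comp hq).continuousAt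
  obtain ⟨G, hG, hGf⟩ := exists_continuous_log hc fun x => h0 _ (hqm x)
  let e := hcl.isEmbedding.toHomeomorph
  refine ⟨fun z => G (Function.invFun γ z : unitInterval), ?_, ?_⟩
  · have : ContinuousOn (fun z => G (Function.invFun γ z : unitInterval)) (range γ) := by
      rw [continuousOn_iff_continuous_domRestrict]
      have h2 : Continuous fun z : range γ => G (e.symm z) :=
        hG.comp (continuous_subtype_val.comp e.symm.continuous)
      refine h2.congr fun z => ?_
      obtain ⟨x, rfl⟩ := e.surjective z
      simp [e, domRestrict, Function.leftInverse_invFun hinj x]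
    exact this.mono (image_subset_range _ _)
  · rintro _ ⟨x, hx, rfl⟩
    have h1 := hGf (x : ℝ)
    have h2 : q x = x := by
      simp only [q]
      rw [projIcc_val, projIcc_of_mem _ hx]
    simp only [h2] at h1
    simp only [Function.leftInverse_invFun hinj x, h1]

end PlaneLog

end

/-! ### Faces, edges and 3-connectedness of plane graphs. -/

section

open Set Filter Topology PlaneLog

/-- The frontier of a component of an open set misses that open set. -/
theorem closure_connectedComponentIn_subset {X : Type*} [TopologicalSpace X] {O : Set X} {a : X}
    (ha : a ∈ O) : closure (connectedComponentIn O a) ∩ O ⊆ connectedComponentIn O a := by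
  rintro z ⟨hz, hzO⟩
  have hpre : IsPreconnected (insert z (connectedComponentIn O a)) :=
    isPreconnected_connectedComponentIn.subset_closure (subset_insert _ _)
      (insert_subset hz subset_closure)
  exact hpre.subset_connectedComponentIn (mem_insert_of_mem _ (mem_connectedComponentIn ha))
    (insert_subset hzO (connectedComponentIn_subset _ _)) (mem_insert _ _)

theorem hasLogOn_singleton {f : Plane → ℂ} {z : Plane} (h : f z ≠ 0) : HasLogOn f {z} :=
  ⟨fun w => Complex.log (f w), continuousOn_singleton _ _, by
    rintro w rfl
    exact Complex.exp_log h⟩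

/-- The pieces are attached to `M` one at a time. A new piece meets the earlier ones only inside
`M`, hence meets what is already built in at most one point, and logarithms glue. -/
theorem hasLogOn_biUnion {ι : Type*} {f : Plane → ℂ} {M : Set Plane} {L : ι → Set Plane}
    (T : Finset ι) (hM : IsClosed M) (hMf : HasLogOn f M) (hL : ∀ i ∈ T, IsClosed (L i))
    (hLf : ∀ i ∈ T, HasLogOn f (L i)) (hML : ∀ i ∈ T, (M ∩ L i).Subsingleton)
    (hLL : ∀ i ∈ T, ∀ j ∈ T, i ≠ j → L i ∩ L j ⊆ M) : HasLogOn f (M ∪ ⋃ i ∈ T, L i) := by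
  classical
  induction T using Finset.induction_on with
  | empty => simpa using hMf
  | insert i T hi ih =>
    have ih' := ih (fun j hj => hL j (Finset.mem_insert_of_mem hj))
      (fun j hj => hLf j (Finset.mem_insert_of_mem hj))
      (fun j hj => hML j (Finset.mem_insert_of_mem hj))
      (fun j hj k hk => hLL j (Finset.mem_insert_of_mem hj) k (Finset.mem_insert_of_mem hk))
    have hmem := Finset.mem_insert_self i T
    have : M ∪ ⋃ j ∈ insert i T, L j = (M ∪ ⋃ j ∈ T, L j) ∪ L i := by
      rw [Finset.set_biUnion_insert, union_comm (L i), union_assoc]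
    rw [this]
    refine ih'.union ?_ (hL i hmem) (hLf i hmem) ?_
    · exact hM.union (T.finite_toSet.isClosed_biUnion fun j hj =>
        hL j (Finset.mem_insert_of_mem hj))
    · have hsub : (M ∪ ⋃ j ∈ T, L j) ∩ L i ⊆ M ∩ L i := by
        rintro z ⟨hz | hz, hzi⟩
        · exact ⟨hz, hzi⟩
        · simp only [mem_iUnion] at hz
          obtain ⟨j, hj, hzj⟩ := hz
          refine ⟨hLL j (Finset.mem_insert_of_mem hj) i hmem ?_ ⟨hzj, hzi⟩, hzi⟩
          rintro rfl
          exact hi hj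
      exact ((hML i hmem).anti hsub).isPreconnected

theorem ncard_pair_le {α : Type*} (a b : α) : ({a, b} : Set α).ncard ≤ 2 := by
  have := Set.ncard_insert_le a {b}
  rwa [Set.ncard_singleton] at this

theorem IsArc.isCompact {x y : Plane} {A : Set Plane} (h : IsArc x y A) : IsCompact A := by
  obtain ⟨γ, hγ, -, -, -, rfl⟩ := h
  exact isCompact_range hγ

theorem IsArc.isPreconnected {x y : Plane} {A : Set Plane} (h : IsArc x y A) :
    IsPreconnected A := by
  obtain ⟨γ, hγ, -, -, -, rfl⟩ := h
  exact isPreconnected_range hγ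

theorem IsArc.ne {x y : Plane} {A : Set Plane} (h : IsArc x y A) : x ≠ y := by
  obtain ⟨γ, -, hinj, rfl, rfl, -⟩ := h
  exact fun h => zero_ne_one (hinj h)

theorem IsArc.left_mem {x y : Plane} {A : Set Plane} (h : IsArc x y A) : x ∈ A := by
  obtain ⟨γ, -, -, rfl, -, rfl⟩ := h
  exact mem_range_self _

theorem IsArc.right_mem {x y : Plane} {A : Set Plane} (h : IsArc x y A) : y ∈ A := by
  obtain ⟨γ, -, -, -, rfl, rfl⟩ := h
  exact mem_range_self _

namespace PlaneGraph

variable {G : PlaneGraph}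

/-- The part of the drawing consisting of all vertices and the edges in `E`. -/
def drawing (G : PlaneGraph) (E : Set (Set Plane)) : Set Plane := G.verts ∪ ⋃₀ E

theorem isCompact_edge {e : Set Plane} (he : e ∈ G.edges) : IsCompact e := by
  obtain ⟨x, -, y, -, h, -⟩ := G.isArc_of_mem e he
  exact h.isCompact

theorem isPreconnected_edge {e : Set Plane} (he : e ∈ G.edges) : IsPreconnected e := by
  obtain ⟨x, -, y, -, h, -⟩ := G.isArc_of_mem e he
  exact h.isPreconnected

theorem isCompact_drawing {E : Set (Set Plane)} (hE : E ⊆ G.edges) :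
    IsCompact (G.drawing E) :=
  G.finite_verts.isCompact.union
    ((G.finite_edges.subset hE).isCompact_sUnion fun _ he => isCompact_edge (hE he))

theorem isCompact_support : IsCompact G.support := isCompact_drawing Subset.rfl

theorem drawing_mono {E E' : Set (Set Plane)} (h : E ⊆ E') : G.drawing E ⊆ G.drawing E' :=
  union_subset_union_right _ (sUnion_subset_sUnion h)

theorem eq_connectedComponentIn {f : Set Plane} (hf : f ∈ G.faces) {a : Plane} (ha : a ∈ f) :
    f = connectedComponentIn G.supportᶜ a := by
  obtain ⟨x, -, rfl⟩ := hf
  exact connectedComponentIn_eq ha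

theorem nonempty_face {f : Set Plane} (hf : f ∈ G.faces) : f.Nonempty := by
  obtain ⟨x, hx, rfl⟩ := hf
  exact ⟨x, mem_connectedComponentIn hx⟩

theorem face_subset {f : Set Plane} (hf : f ∈ G.faces) : f ⊆ G.supportᶜ := by
  obtain ⟨x, hx, rfl⟩ := hf
  exact connectedComponentIn_subset _ _

theorem isPreconnected_face {f : Set Plane} (hf : f ∈ G.faces) : IsPreconnected f := by
  obtain ⟨x, hx, rfl⟩ := hf
  exact isPreconnected_connectedComponentIn

theorem isOpen_face {f : Set Plane} (hf : f ∈ G.faces) : IsOpen f := by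
  obtain ⟨x, hx, rfl⟩ := hf
  exact isCompact_support.isClosed.isOpen_compl.connectedComponentIn

theorem frontier_face_subset {f : Set Plane} (hf : f ∈ G.faces) : frontier f ⊆ G.support := by
  intro z hz
  by_contra hzK
  have hfo := isOpen_face hf
  obtain ⟨x, hx, rfl⟩ := hf
  have h1 := closure_connectedComponentIn_subset hx ⟨frontier_subset_closure hz, hzK⟩
  rw [hfo.frontier_eq] at hz
  exact hz.2 h1

/-- Two faces meeting at an inner point of an edge lie in a common component of the complement of
the drawing without that edge. -/
theorem exists_isPreconnected_of_mem_frontier {e f f' : Set Plane} (he : e ∈ G.edges)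
    (hf : f ∈ G.faces) (hf' : f' ∈ G.faces) {p : Plane} (hpe : p ∈ e) (hpV : p ∉ G.verts)
    (hp : p ∈ frontier f) (hp' : p ∈ frontier f') :
    ∃ S, IsPreconnected S ∧ S ⊆ (G.drawing (G.edges \ {e}))ᶜ ∧ f ⊆ S ∧ f' ⊆ S := by
  have hpD : p ∈ (G.drawing (G.edges \ {e}))ᶜ := by
    rintro (h | ⟨e', he', h⟩)
    · exact hpV h
    · exact hpV (G.inter_subset e he e' he'.1 (fun h => he'.2 h.symm) ⟨hpe, h⟩)
  obtain ⟨r, hr, hrD⟩ := Metric.isOpen_iff.1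
    (isCompact_drawing (G := G) (E := G.edges \ {e}) sdiff_subset).isClosed.isOpen_compl p hpD
  have hball : IsPreconnected (Metric.ball p r) := (convex_ball p r).isPreconnected
  have hsub : G.supportᶜ ⊆ (G.drawing (G.edges \ {e}))ᶜ :=
    compl_subset_compl.2 (drawing_mono sdiff_subset)
  have hmeet : ∀ g : Set Plane, p ∈ frontier g → (Metric.ball p r ∩ g).Nonempty := fun g hg =>
    mem_closure_iff.1 (frontier_subset_closure hg) _ Metric.isOpen_ball (Metric.mem_ball_self hr)
  refine ⟨(Metric.ball p r ∪ f) ∪ f', ?_, ?_, ?_, ?_⟩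
  · refine IsPreconnected.union' ?_ (IsPreconnected.union' (hmeet f hp) hball
      (isPreconnected_face hf)) (isPreconnected_face hf')
    exact (hmeet f' hp').mono (inter_subset_inter_left _ subset_union_left)
  · exact union_subset (union_subset hrD ((face_subset hf).trans hsub))
      ((face_subset hf').trans hsub)
  · exact subset_union_right.trans subset_union_left
  · exact subset_union_right

theorem drawing_union_edge {e : Set Plane} (he : e ∈ G.edges) :
    G.drawing (G.edges \ {e}) ∪ e = G.support := by
  ext z
  simp only [drawing, support, mem_union, mem_sUnion, Set.mem_sdiff,
    mem_singleton_iff]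
  constructor
  · rintro ((h | ⟨g, hg, h⟩) | h)
    · exact Or.inl h
    · exact Or.inr ⟨g, hg.1, h⟩
    · exact Or.inr ⟨e, he, h⟩
  · rintro (h | ⟨g, hg, h⟩)
    · exact Or.inl (Or.inl h)
    · by_cases hge : g = e
      · exact Or.inr (hge ▸ h)
      · exact Or.inl (Or.inr ⟨g, ⟨hg, hge⟩, h⟩)

theorem drawing_inter_edge_subset {e : Set Plane} (he : e ∈ G.edges) :
    G.drawing (G.edges \ {e}) ∩ e ⊆ e ∩ G.verts := by
  rintro z ⟨h | ⟨g, hg, h⟩, hz⟩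
  · exact ⟨hz, h⟩
  · exact ⟨hz, G.inter_subset g hg.1 e he hg.2 ⟨h, hz⟩⟩

theorem hasLogOn_edge {e : Set Plane} (he : e ∈ G.edges) {a b : Plane} (ha : a ∉ G.support)
    (hb : b ∉ G.support) : HasLogOn (quot a b) e := by
  obtain ⟨x, -, y, -, ⟨γ, hγ, hinj, -, -, rfl⟩, -⟩ := G.isArc_of_mem e he
  have hne : ∀ c ∉ G.support, ∀ z ∈ γ '' Icc 0 1, z ≠ c := by
    rintro c hc _ ⟨t, -, rfl⟩ rfl
    exact hc (Or.inr ⟨_, he, mem_range_self _⟩)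
  have := hasLogOn_image_Icc hγ hinj 0 1 (f := quot a b)
    (fun z hz => continuousAt_quot (hne b hb z hz))
    (fun z hz => quot_ne_zero (hne a ha z hz) (hne b hb z hz))
  refine this.mono ?_
  rintro _ ⟨t, rfl⟩
  exact ⟨t, ⟨unitInterval.nonneg', unitInterval.le_one'⟩, rfl⟩

theorem exists_int_sub_eq {g h : Plane → ℂ} {z : Plane} {w : ℂ} (hg : Complex.exp (g z) = w)
    (hh : Complex.exp (h z) = w) : ∃ n : ℤ, g z - h z = n * (2 * Real.pi * Complex.I) := by
  obtain ⟨n, hn⟩ := Complex.exp_eq_exp_iff_exists_int.1 (hg.trans hh.symm)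
  exact ⟨n, by rw [hn]; ring⟩

/-- An inner point of an edge lies on the boundary of at most two faces. -/
theorem eq_of_mem_frontier_three {e f₁ f₂ f₃ : Set Plane} (he : e ∈ G.edges)
    (hf₁ : f₁ ∈ G.faces) (hf₂ : f₂ ∈ G.faces) (hf₃ : f₃ ∈ G.faces) {p : Plane} (hpe : p ∈ e)
    (hpV : p ∉ G.verts) (hp₁ : p ∈ frontier f₁) (hp₂ : p ∈ frontier f₂)
    (hp₃ : p ∈ frontier f₃) : f₁ = f₂ ∨ f₁ = f₃ ∨ f₂ = f₃ := by
  by_contra! hne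
  obtain ⟨h12, h13, h23⟩ := hne
  obtain ⟨a, ha⟩ := nonempty_face hf₁
  obtain ⟨b, hb⟩ := nonempty_face hf₂
  obtain ⟨c, hc⟩ := nonempty_face hf₃
  have haK := face_subset hf₁ ha
  have hbK := face_subset hf₂ hb
  have hcK := face_subset hf₃ hc
  have hK := G.isCompact_support
  rw [eq_connectedComponentIn hf₁ ha, eq_connectedComponentIn hf₂ hb] at h12
  rw [eq_connectedComponentIn hf₁ ha, eq_connectedComponentIn hf₃ hc] at h13
  rw [eq_connectedComponentIn hf₂ hb, eq_connectedComponentIn hf₃ hc] at h23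
  have hD := isCompact_drawing (G := G) (E := G.edges \ {e}) sdiff_subset
  obtain ⟨S, hS, hSD, haS, hcS⟩ :=
    exists_isPreconnected_of_mem_frontier he hf₁ hf₃ hpe hpV hp₁ hp₃
  obtain ⟨T, hT, hTD, hbT, hcT⟩ :=
    exists_isPreconnected_of_mem_frontier he hf₂ hf₃ hpe hpV hp₂ hp₃
  obtain ⟨G₁, hG₁, hG₁E⟩ := hasLogOn_quot_of_mem hD.isClosed hS hSD (haS ha) (hcS hc)
  obtain ⟨G₂, hG₂, hG₂E⟩ := hasLogOn_quot_of_mem hD.isClosed hT hTD (hbT hb) (hcT hc)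
  obtain ⟨H₁, hH₁, hH₁E⟩ := hasLogOn_edge he haK hcK
  obtain ⟨H₂, hH₂, hH₂E⟩ := hasLogOn_edge he hbK hcK
  obtain ⟨x, hx, y, hy, -, hxy⟩ := G.isArc_of_mem e he
  have hxe : x ∈ e := (hxy.symm ▸ mem_insert x {y} : x ∈ e ∩ G.verts).1
  have hye : y ∈ e := (hxy.symm ▸ mem_insert_of_mem x rfl : y ∈ e ∩ G.verts).1
  obtain ⟨n₁, hn₁⟩ := exists_int_sub_eq (hG₁E x (Or.inl hx)) (hH₁E x hxe)
  obtain ⟨n₁', hn₁'⟩ := exists_int_sub_eq (hG₁E y (Or.inl hy)) (hH₁E y hye)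
  obtain ⟨n₂, hn₂⟩ := exists_int_sub_eq (hG₂E x (Or.inl hx)) (hH₂E x hxe)
  obtain ⟨n₂', hn₂'⟩ := exists_int_sub_eq (hG₂E y (Or.inl hy)) (hH₂E y hye)
  have hint : ∀ z ∈ G.drawing (G.edges \ {e}) ∩ e, z = x ∨ z = y := fun z hz => by
    have := drawing_inter_edge_subset he hz
    rw [hxy] at this
    simpa using this
  -- Up to a factor 2πi, `l` and `k` are the obstructions to gluing the logarithms of `quot a c` and
  -- `quot b c` across the two ends of `e`. Raising these quotients to the powers `k` and `-l` makes
  -- the obstructions cancel in the product.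
  set k := n₂ - n₂' with hk
  set l := n₁ - n₁' with hl
  have hglue : HasLogOn (fun z => quot a c z ^ k * quot b c z ^ (-l)) G.support := by
    rw [← drawing_union_edge he]
    refine hasLogOn_union (g := fun z => k * G₁ z + ((-l : ℤ) : ℂ) * G₂ z)
      (h := fun z => k * H₁ z + ((-l : ℤ) : ℂ) * H₂ z) hD.isClosed (isCompact_edge he).isClosed
      (by fun_prop) (fun z hz => ?_) (by fun_prop) (fun z hz => ?_) ?_
    · rw [Complex.exp_add, Complex.exp_int_mul, Complex.exp_int_mul, hG₁E z hz, hG₂E z hz]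
    · rw [Complex.exp_add, Complex.exp_int_mul, Complex.exp_int_mul, hH₁E z hz, hH₂E z hz]
    · have hk' : (k : ℂ) = n₂ - n₂' := by rw [hk]; push_cast; ring
      have hl' : (l : ℂ) = n₁ - n₁' := by rw [hl]; push_cast; ring
      have key : k * G₁ x + ((-l : ℤ) : ℂ) * G₂ x - (k * H₁ x + ((-l : ℤ) : ℂ) * H₂ x) =
          k * G₁ y + ((-l : ℤ) : ℂ) * G₂ y - (k * H₁ y + ((-l : ℤ) : ℂ) * H₂ y) := by
        push_cast
        rw [hk', hl']
        linear_combination (n₂ - n₂' : ℂ) * hn₁ - (n₁ - n₁' : ℂ) * hn₂ -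
          (n₂ - n₂' : ℂ) * hn₁' + (n₁ - n₁' : ℂ) * hn₂'
      intro z hz w hw
      rcases hint z hz with rfl | rfl <;> rcases hint w hw with rfl | rfl
      · rfl
      · exact key
      · exact key.symm
      · rfl
  have hsupp : ∀ z ∈ G.support, coord z - coord a ≠ 0 ∧ coord z - coord b ≠ 0 ∧
      coord z - coord c ≠ 0 := fun z hz =>
    ⟨coord_sub_ne_zero (by rintro rfl; exact haK hz),
      coord_sub_ne_zero (by rintro rfl; exact hbK hz),
      coord_sub_ne_zero (by rintro rfl; exact hcK hz)⟩
  have hform : ∀ z ∈ G.support, quot a c z ^ k * quot b c z ^ (-l) =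
      (coord z - coord a) ^ k * (coord z - coord b) ^ (-l) * (coord z - coord c) ^ (l - k) := by
    intro z hz
    obtain ⟨ha', hb', hc'⟩ := hsupp z hz
    clear_value k l
    simp only [quot, div_zpow]
    rw [zpow_sub₀ hc', zpow_neg, zpow_neg]
    have := zpow_ne_zero k hc'
    have := zpow_ne_zero l hc'
    have := zpow_ne_zero l hb'
    field_simp
  have hnot : ∀ {u v : Plane}, v ∉ G.support → connectedComponentIn G.supportᶜ u ≠
      connectedComponentIn G.supportᶜ v → v ∉ connectedComponentIn G.supportᶜ u :=
    fun _ h h' => h (connectedComponentIn_eq h')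
  have c1 : Bornology.IsBounded (connectedComponentIn G.supportᶜ a) → k = 0 := fun hbd =>
    exponent_eq_zero hK.isClosed haK hbK hcK hbd (hnot hbK h12) (hnot hcK h13)
      (hglue.congr hform)
  have c2 : Bornology.IsBounded (connectedComponentIn G.supportᶜ b) → -l = 0 := fun hbd =>
    exponent_eq_zero hK.isClosed hbK haK hcK hbd (hnot haK h12.symm) (hnot hcK h23)
      (hglue.congr fun z hz => (hform z hz).trans
        (by rw [mul_comm ((coord z - coord a) ^ k)]))
  have c3 : Bornology.IsBounded (connectedComponentIn G.supportᶜ c) → l - k = 0 := fun hbd =>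
    exponent_eq_zero hK.isClosed hcK haK hbK hbd (hnot haK h13.symm) (hnot hbK h23.symm)
      (hglue.congr fun z hz => (hform z hz).trans
        (by rw [mul_comm, mul_assoc]))
  have d12 := isBounded_or_isBounded hK.isBounded (hnot hbK h12) hbK
  have d13 := isBounded_or_isBounded hK.isBounded (hnot hcK h13) hcK
  have d23 := isBounded_or_isBounded hK.isBounded (hnot hcK h23) hcK
  -- At most one of the three faces is unbounded, so two of the exponents `k`, `-l`, `l - k` vanish;
  -- their sum is zero, so all three do.
  have hl0 : l = 0 := by
    rcases d12 with h1 | h1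
    · rcases d23 with h2 | h2
      · have := c2 h2
        omega
      · have := c1 h1
        have := c3 h2
        omega
    · have := c2 h1
      omega
  -- With `l = 0` the logarithms of `quot a c` already glue, so the drawing does not separate `a`
  -- from `c`.
  have : HasLogOn (quot a c) G.support := by
    rw [← drawing_union_edge he]
    refine hasLogOn_union hD.isClosed (isCompact_edge he).isClosed hG₁ hG₁E hH₁ hH₁E ?_
    have h0 : (n₁ : ℂ) = n₁' := by
      have : n₁ = n₁' := by omega
      rw [this]
    have key : G₁ x - H₁ x = G₁ y - H₁ y := by rw [hn₁, hn₁', h0]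
    intro z hz w hw
    rcases hint z hz with rfl | rfl <;> rcases hint w hw with rfl | rfl
    · rfl
    · exact key
    · exact key.symm
    · rfl
  exact hnot hcK h13 (mem_of_hasLogOn_quot hK haK hcK this)

/-- In a 3-connected plane graph no set of vertices is cut off by two edges. -/
theorem subset_of_closed_off_two_edges (hconn : G.IsThreeConnected) {e e' : Set Plane}
    (he : e ∈ G.edges) (he' : e' ∈ G.edges) {A : Set Plane} (hA : A ⊆ G.verts)
    (hne : A.Nonempty)
    (hcl : ∀ g ∈ G.edges, g ≠ e → g ≠ e' → ∀ u ∈ g ∩ A, ∀ v ∈ g ∩ G.verts, v ∈ A) :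
    G.verts ⊆ A := by
  by_contra hVA
  obtain ⟨y, hyV, hyA⟩ := not_subset.1 hVA
  obtain ⟨x, hxA⟩ := hne
  -- Removing one end of `e` and one end of `e'` destroys both exceptional edges but leaves the
  -- graph connected, so the surviving vertices all lie in `A` or all outside it.
  have step : ∀ p ∈ e ∩ G.verts, ∀ q ∈ e' ∩ G.verts,
      A ⊆ {p, q} ∨ G.verts \ A ⊆ {p, q} := by
    intro p hp q hq
    by_contra! hcon
    obtain ⟨h1, h2⟩ := hcon
    obtain ⟨u, huA, hu⟩ := not_subset.1 h1
    obtain ⟨w, ⟨hwV, hwA⟩, hw⟩ := not_subset.1 h2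
    let S : Set G.verts := {⟨p, hp.2⟩, ⟨q, hq.2⟩}
    have hmemS : ∀ z : G.verts, z ∈ S ↔ (z : Plane) ∈ ({p, q} : Set Plane) := by
      intro z
      simp [S, Subtype.ext_iff]
    have hc := hconn.2 S (ncard_pair_le _ _)
    obtain ⟨W⟩ := hc.preconnected ⟨⟨u, hA huA⟩, fun h => hu ((hmemS _).1 h)⟩
      ⟨⟨w, hwV⟩, fun h => hw ((hmemS _).1 h)⟩
    have : ∀ {s t} (W : (G.graph.induce Sᶜ).Walk s t), (s.1 : Plane) ∈ A → (t.1 : Plane) ∈ A := by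
      intro s t W
      induction W with
      | nil => exact id
      | @cons s t r hadj W ih =>
        intro hs
        apply ih
        obtain ⟨hst, g, hg, hsg, htg⟩ : G.graph.Adj s.1 t.1 := hadj
        have hst' : (s.1 : Plane) ≠ t.1 := fun h => hst (Subtype.ext h)
        have hend : ∀ d ∈ G.edges, (s.1 : Plane) ∈ d → (t.1 : Plane) ∈ d →
            ∀ p ∈ d ∩ G.verts, p = s.1 ∨ p = t.1 := by
          intro d hd hs' ht' p hp
          obtain ⟨i, -, j, -, -, hij⟩ := G.isArc_of_mem d hd
          have h1 : (s.1 : Plane) ∈ d ∩ G.verts := ⟨hs', s.1.2⟩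
          have h2 : (t.1 : Plane) ∈ d ∩ G.verts := ⟨ht', t.1.2⟩
          rw [hij] at h1 h2 hp
          simp only [mem_insert_iff, mem_singleton_iff] at h1 h2 hp
          grind
        have hSs : (s.1 : Plane) ∉ ({p, q} : Set Plane) := fun h => s.2 ((hmemS _).2 h)
        have hSt : (t.1 : Plane) ∉ ({p, q} : Set Plane) := fun h => t.2 ((hmemS _).2 h)
        refine hcl g hg ?_ ?_ s.1 ⟨hsg, hs⟩ t.1 ⟨htg, t.1.2⟩
        · rintro rfl
          have := hend g hg hsg htg p hp
          simp only [mem_insert_iff, mem_singleton_iff] at hSs hSt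
          grind
        · rintro rfl
          have := hend g hg hsg htg q hq
          simp only [mem_insert_iff, mem_singleton_iff] at hSs hSt
          grind
    exact hwA (this W huA)
  obtain ⟨a, haV, b, hbV, hab, heV⟩ := G.isArc_of_mem e he
  obtain ⟨a', haV', b', hbV', hab', heV'⟩ := G.isArc_of_mem e' he'
  have hab := IsArc.ne hab
  have hab' := IsArc.ne hab'
  rw [heV, heV'] at step
  have hnot : ∀ z : Plane, ∃ p ∈ ({a, b} : Set Plane), ∃ q ∈ ({a', b'} : Set Plane),
      z ∉ ({p, q} : Set Plane) := by
    intro z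
    obtain ⟨p, hp, hzp⟩ : ∃ p ∈ ({a, b} : Set Plane), z ≠ p := by
      by_cases h : z = a
      · exact ⟨b, by simp, h ▸ hab⟩
      · exact ⟨a, by simp, h⟩
    obtain ⟨q, hq, hzq⟩ : ∃ q ∈ ({a', b'} : Set Plane), z ≠ q := by
      by_cases h : z = a'
      · exact ⟨b', by simp, h ▸ hab'⟩
      · exact ⟨a', by simp, h⟩
    exact ⟨p, hp, q, hq, by simp [hzp, hzq]⟩
  obtain ⟨p', hp', q', hq', hx⟩ := hnot x
  have hB := (step p' hp' q' hq').resolve_left fun h => hx (h hxA)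
  obtain ⟨p, hp, q, hq, hy⟩ := hnot y
  have hA' := (step p hp q hq).resolve_right fun h => hy (h ⟨hyV, hyA⟩)
  -- The only surviving possibility is four distinct vertices, `p` and `q` in `A`, `p'` and `q'`
  -- outside. The mixed choice `p`, `q'` of ends then leaves `q` and `p'` on different sides.
  have hcover : ∀ z ∈ G.verts, z = p ∨ z = q ∨ z = p' ∨ z = q' := by
    intro z hz
    by_cases hzA : z ∈ A
    · have := hA' hzA
      simp only [mem_insert_iff, mem_singleton_iff] at this
      tauto
    · have := hB ⟨hz, hzA⟩
      simp only [mem_insert_iff, mem_singleton_iff] at this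
      tauto
  have h3 : ∀ i j k : Plane, ¬ G.verts ⊆ {i, j, k} := by
    intro i j k h
    have h1 := ncard_le_ncard h (by simp)
    have h2 := ncard_insert_le i {j, k}
    have h3 := ncard_pair_le j k
    have := hconn.1
    omega
  have n1 : p ≠ p' := by
    rintro rfl
    exact h3 p q q' fun z hz => by
      have := hcover z hz
      simp only [mem_insert_iff, mem_singleton_iff]
      tauto
  have n2 : q ≠ q' := by
    rintro rfl
    exact h3 p q p' fun z hz => by
      have := hcover z hz
      simp only [mem_insert_iff, mem_singleton_iff]
      tauto
  have n3 : p ≠ q := by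
    rintro rfl
    exact h3 p p' q' fun z hz => by
      have := hcover z hz
      simp only [mem_insert_iff, mem_singleton_iff]
      tauto
  have n4 : p' ≠ q' := by
    rintro rfl
    exact h3 p q p' fun z hz => by
      have := hcover z hz
      simp only [mem_insert_iff, mem_singleton_iff]
      tauto
  have n5 : p ≠ q' := by
    rintro rfl
    exact h3 p q p' fun z hz => by
      have := hcover z hz
      simp only [mem_insert_iff, mem_singleton_iff]
      tauto
  have n6 : p' ≠ q := by
    rintro rfl
    exact h3 p p' q' fun z hz => by
      have := hcover z hz
      simp only [mem_insert_iff, mem_singleton_iff]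
      tauto
  have hqV : q ∈ G.verts := by
    rcases hq with rfl | rfl
    · exact haV'
    · exact hbV'
  have hpV' : p' ∈ G.verts := by
    rcases hp' with rfl | rfl
    · exact haV
    · exact hbV
  have hqA : q ∈ A := by
    by_contra h
    have := hB ⟨hqV, h⟩
    simp only [mem_insert_iff, mem_singleton_iff] at this
    grind
  have hpA' : p' ∉ A := by
    intro h
    have := hA' h
    simp only [mem_insert_iff, mem_singleton_iff] at this
    grind
  rcases step p hp q' hq' with h | h
  · have := h hqA
    simp only [mem_insert_iff, mem_singleton_iff] at this
    grind
  · have := h ⟨hpV', hpA'⟩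
    simp only [mem_insert_iff, mem_singleton_iff] at this
    grind

/-- The component of one vertex contains every remaining edge that it meets. Its vertices are
therefore closed off by the two deleted edges and must be all vertices. -/
theorem isPreconnected_drawing_diff_pair (hconn : G.IsThreeConnected) {e e' : Set Plane}
    (he : e ∈ G.edges) (he' : e' ∈ G.edges) :
    IsPreconnected (G.drawing (G.edges \ {e, e'})) := by
  obtain ⟨v, hv⟩ : G.verts.Nonempty := by
    apply nonempty_of_ncard_ne_zero
    have := hconn.1
    omega
  set D := G.drawing (G.edges \ {e, e'}) with hD
  have hedge : ∀ g ∈ G.edges \ {e, e'}, ∀ u ∈ g, u ∈ connectedComponentIn D v →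
      g ⊆ connectedComponentIn D v := by
    intro g hg u hu huC
    rw [connectedComponentIn_eq huC]
    exact (isPreconnected_edge hg.1).subset_connectedComponentIn hu
      fun z hz => Or.inr ⟨g, hg, hz⟩
  have hV : G.verts ⊆ G.verts ∩ connectedComponentIn D v := by
    refine subset_of_closed_off_two_edges hconn he he' inter_subset_left
      ⟨v, hv, mem_connectedComponentIn (Or.inl hv)⟩ ?_
    intro g hg h1 h2 u hu w hw
    exact ⟨hw.2, hedge g ⟨hg, by simp [h1, h2]⟩ u hu.1 hu.2.2 hw.1⟩
  have : D = connectedComponentIn D v := by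
    refine Subset.antisymm ?_ (connectedComponentIn_subset _ _)
    rintro z (hz | ⟨g, hg, hz⟩)
    · exact (hV hz).2
    · obtain ⟨x, hx, y, -, -, hxy⟩ := G.isArc_of_mem g hg.1
      have hxg : x ∈ g := (hxy.symm ▸ mem_insert x {y} : x ∈ g ∩ G.verts).1
      exact hedge g hg x hxg (hV hx).2 hz
  rw [this]
  exact isPreconnected_connectedComponentIn

/-- In a 3-connected plane graph two different faces share at most one edge. -/
theorem eq_of_mem_frontier_two (hconn : G.IsThreeConnected) {e e' f f' : Set Plane}
    (he : e ∈ G.edges) (he' : e' ∈ G.edges) (hf : f ∈ G.faces) (hf' : f' ∈ G.faces)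
    (hff' : f ≠ f') {p p' : Plane} (hpe : p ∈ e) (hpV : p ∉ G.verts) (hpe' : p' ∈ e')
    (hpV' : p' ∉ G.verts) (hpf : p ∈ frontier f) (hpf' : p ∈ frontier f')
    (hpf₁ : p' ∈ frontier f) (hpf₁' : p' ∈ frontier f') : e = e' := by
  by_contra hee
  obtain ⟨a, ha⟩ := nonempty_face hf
  obtain ⟨b, hb⟩ := nonempty_face hf'
  obtain ⟨S, hS, hSD, haS, hbS⟩ :=
    exists_isPreconnected_of_mem_frontier he hf hf' hpe hpV hpf hpf'
  obtain ⟨T, hT, hTD, haT, hbT⟩ :=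
    exists_isPreconnected_of_mem_frontier he' hf hf' hpe' hpV' hpf₁ hpf₁'
  have hD := (isCompact_drawing (G := G) (E := G.edges \ {e}) sdiff_subset).isClosed
  have hD' := (isCompact_drawing (G := G) (E := G.edges \ {e'}) sdiff_subset).isClosed
  have h1 := hasLogOn_quot_of_mem hD hS hSD (haS ha) (hbS hb)
  have h2 := hasLogOn_quot_of_mem hD' hT hTD (haT ha) (hbT hb)
  have hinter : G.drawing (G.edges \ {e}) ∩ G.drawing (G.edges \ {e'}) =
      G.drawing (G.edges \ {e, e'}) := by
    ext z
    constructor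
    · rintro ⟨h | ⟨g, hg, h⟩, h' | ⟨g', hg', h'⟩⟩
      · exact Or.inl h
      · exact Or.inl h
      · exact Or.inl h'
      · by_cases hgg : g = g'
        · subst hgg
          refine Or.inr ⟨g, ⟨hg.1, ?_⟩, h⟩
          simp only [mem_insert_iff, mem_singleton_iff, not_or]
          exact ⟨hg.2, hg'.2⟩
        · exact Or.inl (G.inter_subset g hg.1 g' hg'.1 hgg ⟨h, h'⟩)
    · intro h
      exact ⟨drawing_mono (sdiff_subset_sdiff_right (by simp)) h,
        drawing_mono (sdiff_subset_sdiff_right (by simp)) h⟩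
  have hunion : G.drawing (G.edges \ {e}) ∪ G.drawing (G.edges \ {e'}) = G.support := by
    refine Subset.antisymm (union_subset (drawing_mono sdiff_subset) (drawing_mono sdiff_subset)) ?_
    rw [← drawing_union_edge he]
    exact union_subset_union_right _ fun z hz => Or.inr ⟨e, ⟨he, hee⟩, hz⟩
  -- Janiszewski: neither drawing with one edge deleted separates the two faces, and the
  -- intersection of these two drawings is the connected drawing without both edges.
  have h3 : HasLogOn (quot a b) G.support := by
    rw [← hunion]
    refine h1.union hD hD' h2 ?_
    rw [hinter]
    exact isPreconnected_drawing_diff_pair hconn he he'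
  have h4 := mem_of_hasLogOn_quot isCompact_support (face_subset hf ha) (face_subset hf' hb) h3
  apply hff'
  rw [eq_connectedComponentIn hf ha, eq_connectedComponentIn hf' hb]
  exact connectedComponentIn_eq h4

/-- The shortest subarc of an edge that contains the points of the edge in a closed set. -/
theorem exists_subarc {e F : Set Plane} (he : e ∈ G.edges) (hF : IsClosed F) :
    ∃ (γ : unitInterval → Plane) (s t : unitInterval), Continuous γ ∧ Function.Injective γ ∧
      γ '' Icc s t ⊆ e ∧ e ∩ F ⊆ γ '' Icc s t ∧ γ '' Icc s t ∩ G.verts ⊆ F := by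
  obtain ⟨x, -, y, -, ⟨γ, hγ, hinj, rfl, rfl, rfl⟩, hV⟩ := G.isArc_of_mem e he
  by_cases hne : (γ ⁻¹' F).Nonempty
  · have hcomp : IsCompact (γ ⁻¹' F) := (hF.preimage hγ).isCompact
    obtain ⟨s, hs⟩ := hcomp.exists_isLeast hne
    obtain ⟨t, ht⟩ := hcomp.exists_isGreatest hne
    refine ⟨γ, s, t, hγ, hinj, image_subset_range _ _, ?_, ?_⟩
    · rintro _ ⟨⟨r, rfl⟩, hr⟩
      exact ⟨r, ⟨hs.2 hr, ht.2 hr⟩, rfl⟩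
    -- A vertex on the edge has parameter 0 or 1, so inside `[s, t]` it can only be at `s` or `t`,
    -- and those parameters were chosen in the preimage of `F`.
    · rintro _ ⟨⟨r, hr, rfl⟩, hrV⟩
      have : γ r ∈ range γ ∩ G.verts := ⟨mem_range_self r, hrV⟩
      rw [hV] at this
      rcases this with h | h
      · have h0 := hinj h
        have : s = r := le_antisymm hr.1 (by rw [h0]; exact unitInterval.nonneg')
        rw [← this]
        exact hs.1
      · have h1 := hinj h
        have : t = r := le_antisymm (by rw [h1]; exact unitInterval.le_one') hr.2
        rw [← this]
        exact ht.1
  · refine ⟨γ, 1, 0, hγ, hinj, image_subset_range _ _, ?_, ?_⟩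
    · rintro _ ⟨⟨r, rfl⟩, hr⟩
      exact absurd ⟨r, hr⟩ hne
    · simp

/-- Every face of a simple plane graph with at least four vertices is incident with at least three
vertices. -/
theorem three_le_faceDegree (hsimple : G.IsSimple) (h4 : 4 ≤ G.verts.ncard) {f : Set Plane}
    (hf : f ∈ G.faces) : 3 ≤ G.faceDegree f := by
  by_contra! hlt
  set V' := G.faceVerts f with hV'
  have hVfin : V'.Finite := G.finite_verts.subset inter_subset_left
  have hV2 : V'.ncard ≤ 2 := by
    have : V'.ncard < 3 := hlt
    omega
  have hex : ∀ e ∈ G.edges, ∃ L : Set Plane, IsClosed L ∧ L ⊆ e ∧ e ∩ frontier f ⊆ L ∧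
      L ∩ G.verts ⊆ frontier f ∧
      ∀ a b, a ∉ L → b ∉ L → HasLogOn (quot a b) L := by
    intro e he
    obtain ⟨γ, s, t, hγ, hinj, h1, h2, h3⟩ := exists_subarc he (isClosed_frontier (s := f))
    refine ⟨γ '' Icc s t, (isCompact_Icc.image hγ).isClosed, h1, h2, h3, ?_⟩
    intro a b ha hb
    refine hasLogOn_image_Icc hγ hinj s t (fun z hz => continuousAt_quot ?_)
      (fun z hz => quot_ne_zero ?_ ?_)
    · rintro rfl
      exact hb hz
    · rintro rfl
      exact ha hz
    · rintro rfl
      exact hb hz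
  choose! L hLcl hLe hLF hLV hLlog using hex
  have hLL : ∀ e ∈ G.edges, ∀ e' ∈ G.edges, e ≠ e' → L e ∩ L e' ⊆ V' := by
    intro e he e' he' hne z hz
    have := G.inter_subset e he e' he' hne ⟨hLe e he hz.1, hLe e' he' hz.2⟩
    exact ⟨this, hLV e he ⟨hz.1, this⟩⟩
  have hLsub : ∀ e ∈ G.edges, L e ∩ G.verts ⊆ V' := fun e he z hz => ⟨hz.2, hLV e he hz⟩
  -- With at most two vertices on the face, the arcs `L e` form no cycle. If one of them contains
  -- two vertices of `V'`, simplicity makes it the only one and it serves as the base `M`; otherwise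
  -- the base is the finite set `V'`. Each remaining arc meets the base in at most one point.
  obtain ⟨M, T, hMcl, hMlog, hTE, hML, hVM, hMV, hMK, hcov⟩ : ∃ (M : Set Plane)
      (T : Set (Set Plane)), IsClosed M ∧
      (∀ a b, a ∉ M → b ∉ M → HasLogOn (quot a b) M) ∧ T ⊆ G.edges ∧
      (∀ e ∈ T, (M ∩ L e).Subsingleton) ∧ V' ⊆ M ∧ M ∩ G.verts ⊆ V' ∧ M ⊆ G.support ∧
      ∀ e ∈ G.edges, e ∈ T ∨ L e ⊆ M := by
    by_cases hcase : ∃ e ∈ G.edges, ¬ (V' ∩ L e).Subsingleton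
    · obtain ⟨e₀, he₀, hsub⟩ := hcase
      have hboth : ∀ e ∈ G.edges, ¬ (V' ∩ L e).Subsingleton → V' = e ∩ G.verts := by
        intro e he hns
        obtain ⟨u, hu, v, hv, huv⟩ := not_subsingleton_iff.1 hns
        have h1 : V' = {u, v} := by
          symm
          apply eq_of_subset_of_ncard_le _ _ hVfin
          · exact insert_subset hu.1 (singleton_subset_iff.2 hv.1)
          · rw [ncard_pair huv]
            exact hV2
        obtain ⟨x, -, y, -, -, hxy⟩ := G.isArc_of_mem e he
        rw [h1]
        apply eq_of_subset_of_ncard_le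
        · exact insert_subset ⟨hLe e he hu.2, hu.1.1⟩
            (singleton_subset_iff.2 ⟨hLe e he hv.2, hv.1.1⟩)
        · rw [ncard_pair huv, hxy]
          exact ncard_pair_le _ _
        · rw [hxy]
          simp
      have hV'e := hboth e₀ he₀ hsub
      refine ⟨L e₀, G.edges \ {e₀}, hLcl e₀ he₀, hLlog e₀ he₀, sdiff_subset, ?_, ?_,
        hLsub e₀ he₀, (hLe e₀ he₀).trans fun z hz => Or.inr ⟨e₀, he₀, hz⟩, ?_⟩
      · intro e he
        by_contra hns
        have h1 : L e₀ ∩ L e ⊆ V' ∩ L e := fun z hz =>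
          ⟨hLL e₀ he₀ e he.1 (fun h => he.2 h.symm) hz, hz.2⟩
        have h2 := hboth e he.1 fun h => hns (h.anti h1)
        exact he.2 (hsimple e he.1 e₀ he₀ (h2.symm.trans hV'e))
      · intro z hz
        have := hV'e ▸ hz
        exact hLF e₀ he₀ ⟨this.1, hz.2⟩
      · intro e he
        by_cases h : e = e₀
        · exact Or.inr (h ▸ Subset.rfl)
        · exact Or.inl ⟨he, h⟩
    · push Not at hcase
      refine ⟨V', G.edges, hVfin.isClosed, ?_, Subset.rfl, hcase, Subset.rfl,
        inter_subset_left, fun z hz => Or.inl hz.1, fun e he => Or.inl he⟩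
      intro a b ha hb
      have := hasLogOn_biUnion (f := quot a b) (M := ∅) (L := fun z => {z}) hVfin.toFinset
        isClosed_empty ⟨fun _ => 0, continuousOn_empty _, by simp⟩ (fun _ _ => isClosed_singleton)
        (fun z hz => hasLogOn_singleton (quot_ne_zero
          (by rintro rfl; exact ha (by simpa using hz))
          (by rintro rfl; exact hb (by simpa using hz))))
        (fun _ _ => by simp) (fun i _ j _ hij => by
          rintro z ⟨h1, h2⟩
          exact hij (h1.symm.trans h2))
      refine this.mono fun z hz => Or.inr ?_
      simpa using hz
  have hTfin : T.Finite := G.finite_edges.subset hTE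
  set N := M ∪ ⋃ e ∈ hTfin.toFinset, L e with hN
  have hNcl : IsClosed N := hMcl.union (Finset.finite_toSet _ |>.isClosed_biUnion fun e he =>
    hLcl e (hTE (by simpa using he)))
  have hNK : N ⊆ G.support := by
    rintro z (hz | hz)
    · exact hMK hz
    · simp only [mem_iUnion, Finite.mem_toFinset] at hz
      obtain ⟨e, he, hz⟩ := hz
      exact Or.inr ⟨e, hTE he, hLe e (hTE he) hz⟩
  have hNV : N ∩ G.verts ⊆ V' := by
    rintro z ⟨hz | hz, hzV⟩
    · exact hMV ⟨hz, hzV⟩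
    · simp only [mem_iUnion, Finite.mem_toFinset] at hz
      obtain ⟨e, he, hz⟩ := hz
      exact hLsub e (hTE he) ⟨hz, hzV⟩
  have hFN : frontier f ⊆ N := by
    intro z hz
    rcases frontier_face_subset hf hz with h | ⟨e, he, h⟩
    · exact Or.inl (hVM ⟨h, hz⟩)
    · rcases hcov e he with h' | h'
      · refine Or.inr ?_
        simp only [mem_iUnion, Finite.mem_toFinset]
        exact ⟨e, h', hLF e he ⟨h, hz⟩⟩
      · exact Or.inl (h' (hLF e he ⟨h, hz⟩))
  -- There are four vertices, so some `v` is off the face. `N` contains the frontier of `f` but,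
  -- carrying a logarithm, does not separate `v` from a point of `f`; then `v` would lie in `f`.
  obtain ⟨v, hvV, hv⟩ : ∃ v ∈ G.verts, v ∉ V' := by
    by_contra! h
    have := ncard_le_ncard h hVfin
    omega
  obtain ⟨a, ha⟩ := nonempty_face hf
  have haN : a ∉ N := fun h => face_subset hf ha (hNK h)
  have hvN : v ∉ N := fun h => hv (hNV ⟨h, hvV⟩)
  have hlog : HasLogOn (quot a v) N := by
    refine hasLogOn_biUnion _ hMcl (hMlog a v (fun h => haN (Or.inl h)) fun h => hvN (Or.inl h))
      ?_ ?_ ?_ ?_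
    · intro e he
      exact hLcl e (hTE (by simpa using he))
    · intro e he
      have hsub : L e ⊆ N := fun z hz => by
        refine Or.inr ?_
        simp only [mem_iUnion]
        exact ⟨e, he, hz⟩
      exact hLlog e (hTE (by simpa using he)) a v (fun h => haN (hsub h)) fun h => hvN (hsub h)
    · intro e he
      exact hML e (by simpa using he)
    · intro e he e' he' hne
      exact (hLL e (hTE (by simpa using he)) e' (hTE (by simpa using he')) hne).trans hVM
  have hmem := mem_of_hasLogOn_quot (isCompact_support.of_isClosed_subset hNcl hNK) haN hvN hlog
  have hsub : connectedComponentIn Nᶜ a ⊆ f := by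
    refine isPreconnected_connectedComponentIn.subset_left_of_subset_union (isOpen_face hf)
      (isClosed_closure (s := f)).isOpen_compl ?_ ?_ ⟨a, mem_connectedComponentIn haN, ha⟩
    · exact disjoint_compl_right_iff_subset.2 subset_closure
    · intro z hz
      by_contra hcon
      simp only [mem_union, mem_compl_iff, not_or, not_not] at hcon
      refine connectedComponentIn_subset _ _ hz (hFN ?_)
      rw [(isOpen_face hf).frontier_eq]
      exact ⟨hcon.2, hcon.1⟩
  exact face_subset hf (hsub hmem) (Or.inl hvV)

theorem exists_face : ∃ f, f ∈ G.faces := by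
  have hne : G.support ≠ univ := fun h => by
    have h1 := G.isCompact_support
    rw [h] at h1
    exact noncompact_univ Plane h1
  obtain ⟨x, hx⟩ := (ne_univ_iff_exists_notMem _).1 hne
  exact ⟨_, x, hx, rfl⟩

end PlaneGraph

end

/-! ### Structure of subdivisions. -/

section

open Set

namespace PlaneGraph

variable {R G G' : PlaneGraph}

theorem exists_mem_notMem_verts {e : Set Plane} (he : e ∈ G.edges) : ∃ p ∈ e, p ∉ G.verts := by
  obtain ⟨x, -, y, -, ⟨γ, -, hinj, rfl, rfl, rfl⟩, hV⟩ := G.isArc_of_mem e he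
  let t : unitInterval := ⟨1 / 2, by norm_num, by norm_num⟩
  refine ⟨γ t, mem_range_self _, fun h => ?_⟩
  have : γ t ∈ range γ ∩ G.verts := ⟨mem_range_self _, h⟩
  rw [hV] at this
  rcases this with h | h
  · have := congrArg Subtype.val (hinj h)
    norm_num [t] at this
  · have := congrArg Subtype.val (hinj h)
    norm_num [t] at this

theorem eq_of_edge_subset {e g : Set Plane} (he : e ∈ G.edges) (hg : g ∈ G.edges) (h : g ⊆ e) :
    g = e := by
  by_contra hne
  obtain ⟨p, hp, hpV⟩ := exists_mem_notMem_verts hg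
  exact hpV (G.inter_subset g hg e he hne ⟨hp, h hp⟩)

/-- `l` lists the edges inside `e`, each with its first end, of a trail of `G` from `x` to `y`. -/
inductive Trail (G : PlaneGraph) (e : Set Plane) (y : Plane) :
    Plane → List (Set Plane × Plane) → Prop
  | nil : Trail G e y y []
  | cons {g x w l} : g ∈ G.edges → g ⊆ e → g ∩ G.verts = {x, w} → Trail G e y w l →
      Trail G e y x ((g, x) :: l)

theorem Trail.start_mem {e : Set Plane} {x y : Plane} {l : List (Set Plane × Plane)}
    (h : Trail G e y x l) : x ∈ l.map Prod.snd ++ [y] := by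
  cases h <;> simp

theorem Trail.mem_verts {e : Set Plane} {x y : Plane} {l : List (Set Plane × Plane)}
    (h : Trail G e y x l) (hy : y ∈ G.verts) {z : Plane} (hz : z ∈ l.map Prod.snd ++ [y]) :
    z ∈ G.verts := by
  induction h with
  | nil =>
    obtain rfl : z = y := by simpa using hz
    exact hy
  | @cons g x w l hg hge hgV hT ih =>
    simp only [List.map_cons, List.cons_append, List.mem_cons] at hz
    rcases hz with rfl | hz
    · exact (hgV.symm ▸ mem_insert z {w} : z ∈ g ∩ G.verts).2
    · exact ih hz

theorem Trail.mem_edge {e : Set Plane} {x y : Plane} {l : List (Set Plane × Plane)}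
    (h : Trail G e y x l) {z : Plane} (hz : z ∈ l.map Prod.snd) : z ∈ e := by
  induction h with
  | nil => simp at hz
  | @cons g x w l hg hge hgV hT ih =>
    simp only [List.map_cons, List.mem_cons] at hz
    rcases hz with rfl | hz
    · exact hge (hgV.symm ▸ mem_insert z {w} : z ∈ g ∩ G.verts).1
    · exact ih hz

theorem Trail.edge_mem {e : Set Plane} {x y : Plane} {l : List (Set Plane × Plane)}
    (h : Trail G e y x l) {g : Set Plane} (hg : g ∈ l.map Prod.fst) :
    g ∈ G.edges ∧ g ⊆ e ∧ ∀ z ∈ g ∩ G.verts, z ∈ l.map Prod.snd ++ [y] := by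
  induction h with
  | nil => simp at hg
  | @cons g' x w l hg' hge hgV hT ih =>
    simp only [List.map_cons, List.mem_cons] at hg
    rcases hg with rfl | hg
    · refine ⟨hg', hge, fun z hz => ?_⟩
      rw [hgV] at hz
      rcases hz with rfl | hz
      · simp
      · rw [mem_singleton_iff] at hz
        subst hz
        exact List.mem_cons_of_mem _ hT.start_mem
    · obtain ⟨h1, h2, h3⟩ := ih hg
      exact ⟨h1, h2, fun z hz => List.mem_cons_of_mem _ (h3 z hz)⟩

/-- The vertices of a trail form a path in the graph. -/
theorem Trail.exists_chain {e : Set Plane} {x y : Plane} {l : List (Set Plane × Plane)}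
    (h : Trail G e y x l) (hl : (l.map Prod.snd).Nodup) :
    ∃ L : List G.verts, L.map Subtype.val = l.map Prod.snd ∧ L.IsChain G.graph.Adj := by
  induction h with
  | nil => exact ⟨[], by simp, by simp⟩
  | @cons g x w l hg hge hgV hT ih =>
    simp only [List.map_cons, List.nodup_cons] at hl
    obtain ⟨L, hL, hc⟩ := ih hl.2
    have hx : x ∈ g ∩ G.verts := hgV.symm ▸ mem_insert x {w}
    have hw : w ∈ g ∩ G.verts := hgV.symm ▸ mem_insert_of_mem x rfl
    refine ⟨⟨x, hx.2⟩ :: L, by simp [hL], ?_⟩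
    cases hT with
    | nil =>
      have : L = [] := List.map_eq_nil_iff.1 hL
      subst this
      simp
    | @cons g' _ w' l' hg' hge' hgV' hT' =>
      cases L with
      | nil => simp at hL
      | cons a L =>
        simp only [List.map_cons, List.cons.injEq] at hL
        refine List.isChain_cons_cons.2 ⟨⟨?_, g, hg, hx.1, hL.1.symm ▸ hw.1⟩, hc⟩
        rintro rfl
        simp only [List.map_cons, List.mem_cons, not_or] at hl
        exact hl.1.1 hL.1

/-- The effect of subdividing the edge `g` at `w` into `e₁` and `e₂`. -/
structure Subdivides (G G' : PlaneGraph) (g : Set Plane) (u v w : Plane) (e₁ e₂ : Set Plane) :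
    Prop where
  mem : g ∈ G.edges
  notMem : w ∉ G.verts
  arc₁ : IsArc u w e₁
  arc₂ : IsArc w v e₂
  union : e₁ ∪ e₂ = g
  inter : e₁ ∩ e₂ = {w}
  verts_eq : G'.verts = insert w G.verts
  edges_eq : G'.edges = (G.edges \ {g}) ∪ {e₁, e₂}
  ends : g ∩ G.verts = {u, v}

theorem IsEdgeSubdivision.exists_subdivides (h : IsEdgeSubdivision G G') :
    ∃ g u v w e₁ e₂, Subdivides G G' g u v w e₁ e₂ := by
  obtain ⟨g, hg, u, hu, v, hv, w, hw, e₁, e₂, h1, h2, h3, h4, h5, h6⟩ := h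
  refine ⟨g, u, v, w, e₁, e₂, hg, hw, h1, h2, h3, h4, h5, h6, ?_⟩
  obtain ⟨a, -, b, -, hab, hV⟩ := G.isArc_of_mem g hg
  have hug : u ∈ g ∩ G.verts := ⟨h3 ▸ Or.inl h1.left_mem, hu⟩
  have hvg : v ∈ g ∩ G.verts := ⟨h3 ▸ Or.inr h2.right_mem, hv⟩
  have huv : u ≠ v := by
    rintro rfl
    have : u ∈ e₁ ∩ e₂ := ⟨h1.left_mem, h2.right_mem⟩
    rw [h4] at this
    exact h1.ne this
  rw [hV] at hug hvg ⊢
  rcases hug with rfl | hu' <;> rcases hvg with rfl | hv'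
  · exact absurd rfl huv
  · rw [mem_singleton_iff.1 hv']
  · rw [mem_singleton_iff.1 hu', pair_comm]
  · exact absurd ((mem_singleton_iff.1 hu').trans (mem_singleton_iff.1 hv').symm) huv

namespace Subdivides

variable {g e₁ e₂ : Set Plane} {u v w : Plane}

/-- This symmetry allows the following facts to be proved for `u` and `e₁` alone. -/
theorem symm (h : Subdivides G G' g u v w e₁ e₂) : Subdivides G G' g v u w e₂ e₁ where
  mem := h.mem
  notMem := h.notMem
  arc₁ := by
    obtain ⟨γ, h1, h2, h3, h4, h5⟩ := h.arc₂
    refine ⟨γ ∘ unitInterval.symm, by fun_prop, h2.comp unitInterval.symm_bijective.injective,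
      by simpa, by simpa, ?_⟩
    rw [unitInterval.symm_bijective.surjective.range_comp, h5]
  arc₂ := by
    obtain ⟨γ, h1, h2, h3, h4, h5⟩ := h.arc₁
    refine ⟨γ ∘ unitInterval.symm, by fun_prop, h2.comp unitInterval.symm_bijective.injective,
      by simpa, by simpa, ?_⟩
    rw [unitInterval.symm_bijective.surjective.range_comp, h5]
  union := by rw [union_comm, h.union]
  inter := by rw [inter_comm, h.inter]
  verts_eq := h.verts_eq
  edges_eq := by rw [h.edges_eq, pair_comm]
  ends := by rw [h.ends, pair_comm]

theorem subset₁ (h : Subdivides G G' g u v w e₁ e₂) : e₁ ⊆ g := h.union ▸ subset_union_left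

theorem mem_w (h : Subdivides G G' g u v w e₁ e₂) : w ∈ g := h.subset₁ h.arc₁.right_mem

theorem left_mem (h : Subdivides G G' g u v w e₁ e₂) : u ∈ g ∩ G.verts :=
  h.ends ▸ mem_insert u {v}

theorem left_ne (h : Subdivides G G' g u v w e₁ e₂) : u ≠ w := h.arc₁.ne

theorem left_notMem (h : Subdivides G G' g u v w e₁ e₂) : u ∉ e₂ := fun hu => by
  have : u ∈ e₁ ∩ e₂ := ⟨h.arc₁.left_mem, hu⟩
  rw [h.inter] at this
  exact h.left_ne this

theorem notMem_of_ne (h : Subdivides G G' g u v w e₁ e₂) {g' : Set Plane} (hg' : g' ∈ G.edges)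
    (hne : g' ≠ g) : w ∉ g' := fun hw =>
  h.notMem (G.inter_subset g' hg' g h.mem hne ⟨hw, h.mem_w⟩)

theorem mem_edges_of_ne (h : Subdivides G G' g u v w e₁ e₂) {g' : Set Plane}
    (hg' : g' ∈ G.edges) (hne : g' ≠ g) : g' ∈ G'.edges :=
  h.edges_eq ▸ Or.inl ⟨hg', hne⟩

theorem mem_edges₁ (h : Subdivides G G' g u v w e₁ e₂) : e₁ ∈ G'.edges :=
  h.edges_eq ▸ Or.inr (mem_insert _ _)

theorem mem_edges_iff (h : Subdivides G G' g u v w e₁ e₂) {g' : Set Plane} :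
    g' ∈ G'.edges ↔ (g' ∈ G.edges ∧ g' ≠ g) ∨ g' = e₁ ∨ g' = e₂ := by
  rw [h.edges_eq]
  rfl

theorem ends_of_ne (h : Subdivides G G' g u v w e₁ e₂) {g' : Set Plane} (hg' : g' ∈ G.edges)
    (hne : g' ≠ g) : g' ∩ G'.verts = g' ∩ G.verts := by
  rw [h.verts_eq, inter_insert_of_notMem (h.notMem_of_ne hg' hne)]

theorem ends₁ (h : Subdivides G G' g u v w e₁ e₂) : e₁ ∩ G'.verts = {u, w} := by
  rw [h.verts_eq]
  ext z
  constructor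
  · rintro ⟨hz, rfl | hzV⟩
    · simp
    · have : z ∈ g ∩ G.verts := ⟨h.subset₁ hz, hzV⟩
      rw [h.ends] at this
      rcases this with rfl | hzv
      · simp
      · rw [mem_singleton_iff] at hzv
        subst hzv
        exact absurd hz h.symm.left_notMem
  · rintro (rfl | hz)
    · exact ⟨h.arc₁.left_mem, Or.inr h.left_mem.2⟩
    · rw [mem_singleton_iff] at hz
      subst hz
      exact ⟨h.arc₁.right_mem, Or.inl rfl⟩

theorem support_eq (h : Subdivides G G' g u v w e₁ e₂) : G'.support = G.support := by
  ext z
  simp only [support, mem_union, mem_sUnion, h.mem_edges_iff, h.verts_eq, mem_insert_iff]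
  constructor
  · rintro ((rfl | hz) | ⟨g', (hg' | rfl | rfl), hz⟩)
    · exact Or.inr ⟨g, h.mem, h.mem_w⟩
    · exact Or.inl hz
    · exact Or.inr ⟨g', hg'.1, hz⟩
    · exact Or.inr ⟨g, h.mem, h.subset₁ hz⟩
    · exact Or.inr ⟨g, h.mem, h.symm.subset₁ hz⟩
  · rintro (hz | ⟨g', hg', hz⟩)
    · exact Or.inl (Or.inr hz)
    · by_cases hne : g' = g
      · subst hne
        rw [← h.union] at hz
        rcases hz with hz | hz
        · exact Or.inr ⟨e₁, Or.inr (Or.inl rfl), hz⟩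
        · exact Or.inr ⟨e₂, Or.inr (Or.inr rfl), hz⟩
      · exact Or.inr ⟨g', Or.inl ⟨hg', hne⟩, hz⟩

theorem degree_new (h : Subdivides G G' g u v w e₁ e₂) : G'.degree w = 2 := by
  have : {e ∈ G'.edges | w ∈ e} = {e₁, e₂} := by
    ext g'
    simp only [Set.mem_ofPred_eq, h.mem_edges_iff, mem_insert_iff, mem_singleton_iff]
    constructor
    · rintro ⟨hg' | hg', hw⟩
      · exact absurd hw (h.notMem_of_ne hg'.1 hg'.2)
      · exact hg'
    · rintro (rfl | rfl)
      · exact ⟨Or.inr (Or.inl rfl), h.arc₁.right_mem⟩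
      · exact ⟨Or.inr (Or.inr rfl), h.arc₂.left_mem⟩
  rw [degree, this, ncard_pair]
  rintro rfl
  exact h.left_notMem h.arc₁.left_mem

theorem degree_left (h : Subdivides G G' g u v w e₁ e₂) : G'.degree u = G.degree u := by
  have : {e ∈ G'.edges | u ∈ e} = insert e₁ ({e ∈ G.edges | u ∈ e} \ {g}) := by
    ext g'
    simp only [Set.mem_ofPred_eq, h.mem_edges_iff, mem_insert_iff, mem_singleton_iff, Set.mem_sdiff]
    constructor
    · rintro ⟨hg' | rfl | rfl, hu⟩
      · exact Or.inr ⟨⟨hg'.1, hu⟩, hg'.2⟩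
      · exact Or.inl rfl
      · exact absurd hu h.left_notMem
    · rintro (rfl | hg')
      · exact ⟨Or.inr (Or.inl rfl), h.arc₁.left_mem⟩
      · exact ⟨Or.inl ⟨hg'.1.1, hg'.2⟩, hg'.1.2⟩
  rw [degree, this, degree]
  -- At `u` the edge `g` is exchanged for `e₁`, which is not an old edge: it lacks the end `v` of
  -- `g`, and no other old edge contains `w`.
  refine ncard_exchange (fun h' => ?_) ⟨h.mem, h.left_mem.1⟩
  by_cases hne : e₁ = g
  · exact h.symm.left_notMem (hne ▸ h.symm.left_mem.1)
  · exact h.notMem_of_ne h'.1 hne h.arc₁.right_mem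

theorem degree_eq (h : Subdivides G G' g u v w e₁ e₂) {z : Plane} (hz : z ∈ G.verts) :
    G'.degree z = G.degree z := by
  by_cases hzg : z ∈ g
  · have : z ∈ g ∩ G.verts := ⟨hzg, hz⟩
    rw [h.ends] at this
    rcases this with rfl | hzv
    · exact h.degree_left
    · rw [mem_singleton_iff] at hzv
      subst hzv
      exact h.symm.degree_left
  · rw [degree, degree]
    congr 1
    ext g'
    simp only [Set.mem_ofPred_eq, h.mem_edges_iff]
    constructor
    · rintro ⟨hg' | rfl | rfl, hzg'⟩
      · exact ⟨hg'.1, hzg'⟩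
      · exact absurd (h.subset₁ hzg') hzg
      · exact absurd (h.symm.subset₁ hzg') hzg
    · rintro ⟨hg', hzg'⟩
      exact ⟨Or.inl ⟨hg', fun h' => hzg (h' ▸ hzg')⟩, hzg'⟩

theorem trail_of_notMem (h : Subdivides G G' g u v w e₁ e₂) {e : Set Plane} {x y : Plane}
    {l : List (Set Plane × Plane)} (hT : Trail G e y x l) (hg : g ∉ l.map Prod.fst) :
    Trail G' e y x l := by
  induction hT with
  | nil => exact .nil
  | @cons g' x z l hg' hge hgV hT ih =>
    simp only [List.map_cons, List.mem_cons, not_or] at hg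
    have hne : g' ≠ g := fun h' => hg.1 h'.symm
    exact .cons (h.mem_edges_of_ne hg' hne) hge ((h.ends_of_ne hg' hne).trans hgV) (ih hg.2)

/-- The entry for `g` is replaced by entries for its two halves, in the order dictated by the
direction of travel. Distinctness of the vertices ensures that `g` occurs once. A permutation is
enough information, because only membership and distinctness are needed later. -/
theorem exists_trail (h : Subdivides G G' g u v w e₁ e₂) {e : Set Plane} {x y : Plane}
    {l : List (Set Plane × Plane)} (hT : Trail G e y x l)
    (hl : (l.map Prod.snd ++ [y]).Nodup) (hg : g ∈ l.map Prod.fst) :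
    ∃ l', Trail G' e y x l' ∧ (l'.map Prod.snd).Perm (w :: l.map Prod.snd) ∧
      (∀ g' ∈ l.map Prod.fst, g' ≠ g → g' ∈ l'.map Prod.fst) ∧
      e₁ ∈ l'.map Prod.fst ∧ e₂ ∈ l'.map Prod.fst := by
  induction hT with
  | nil => simp at hg
  | @cons g' x z l hg' hge hgV hT ih =>
    simp only [List.map_cons, List.cons_append, List.nodup_cons] at hl
    by_cases hne : g' = g
    · subst hne
      have hnot : g' ∉ l.map Prod.fst := fun hmem =>
        hl.1 ((hT.edge_mem hmem).2.2 x (hgV.symm ▸ mem_insert x {z}))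
      have hT' := h.trail_of_notMem hT hnot
      have hsplit : ∀ {u v e₁ e₂}, Subdivides G G' g' u v w e₁ e₂ → x = u → z = v →
          Trail G' e y x ((e₁, x) :: (e₂, w) :: l) := by
        rintro u v e₁ e₂ h rfl rfl
        exact .cons h.mem_edges₁ (h.subset₁.trans hge) h.ends₁
          (.cons h.symm.mem_edges₁ (h.symm.subset₁.trans hge) (by rw [h.symm.ends₁, pair_comm]) hT')
      have hcase : (x = u ∧ z = v) ∨ (x = v ∧ z = u) := by
        have h1 := h.ends
        rw [hgV] at h1
        exact pair_eq_pair_iff.1 h1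
      rcases hcase with ⟨hx, hz⟩ | ⟨hx, hz⟩
      · refine ⟨_, hsplit h hx hz, ?_, ?_, by simp, by simp⟩
        · simpa using List.Perm.swap _ _ _
        · intro g'' hg'' hne
          simp only [List.map_cons, List.mem_cons] at hg'' ⊢
          tauto
      · refine ⟨_, hsplit h.symm hx hz, ?_, ?_, by simp, by simp⟩
        · simpa using List.Perm.swap _ _ _
        · intro g'' hg'' hne
          simp only [List.map_cons, List.mem_cons] at hg'' ⊢
          tauto
    · simp only [List.map_cons, List.mem_cons] at hg
      obtain ⟨l', h1, h2, h3, h4, h5⟩ := ih hl.2 (hg.resolve_left fun h' => hne h'.symm)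
      refine ⟨(g', x) :: l', .cons (h.mem_edges_of_ne hg' hne) hge
        ((h.ends_of_ne hg' hne).trans hgV) h1, ?_, ?_, ?_, ?_⟩
      · simp only [List.map_cons]
        exact (h2.cons x).trans (List.Perm.swap _ _ _)
      · intro g'' hg'' hne'
        simp only [List.map_cons, List.mem_cons] at hg'' ⊢
        exact hg''.imp_right fun h' => h3 g'' h' hne'
      · exact List.mem_cons_of_mem _ h4
      · exact List.mem_cons_of_mem _ h5

end Subdivides

/-- The structure of a subdivision relative to the original plane graph. -/
structure Refines (R G : PlaneGraph) : Prop where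
  support_eq : G.support = R.support
  verts_subset : R.verts ⊆ G.verts
  degree_eq : ∀ z ∈ G.verts, z ∉ R.verts → G.degree z = 2
  exists_edge : ∀ g ∈ G.edges, ∃ e ∈ R.edges, g ⊆ e
  exists_trail : ∀ e ∈ R.edges, ∃ x y l, e ∩ R.verts = {x, y} ∧ Trail G e y x l ∧
    (l.map Prod.snd ++ [y]).Nodup ∧ (∀ z ∈ G.verts, z ∈ e → z ∈ l.map Prod.snd ++ [y]) ∧
    ∀ g ∈ G.edges, g ⊆ e → g ∈ l.map Prod.fst

theorem Refines.refl : Refines R R where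
  support_eq := rfl
  verts_subset := Subset.rfl
  degree_eq := fun z h h' => absurd h h'
  exists_edge := fun g hg => ⟨g, hg, Subset.rfl⟩
  exists_trail := by
    intro e he
    obtain ⟨x, -, y, -, hxy, hV⟩ := R.isArc_of_mem e he
    refine ⟨x, y, [(e, x)], hV, .cons he Subset.rfl hV .nil, ?_, ?_, ?_⟩
    · simpa using hxy.ne
    · intro z hz hze
      have : z ∈ e ∩ R.verts := ⟨hze, hz⟩
      rw [hV] at this
      simpa using this
    · intro g hg hge
      simp [eq_of_edge_subset he hg hge]

theorem Refines.subdivide (hR : Refines R G) {g e₁ e₂ : Set Plane} {u v w : Plane}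
    (h : Subdivides G G' g u v w e₁ e₂) : Refines R G' where
  support_eq := h.support_eq.trans hR.support_eq
  verts_subset := hR.verts_subset.trans (h.verts_eq ▸ subset_insert _ _)
  degree_eq := by
    intro z hz hzR
    rw [h.verts_eq] at hz
    rcases hz with rfl | hz
    · exact h.degree_new
    · rw [h.degree_eq hz]
      exact hR.degree_eq z hz hzR
  exists_edge := by
    intro g' hg'
    obtain ⟨e, he, hge⟩ := hR.exists_edge g h.mem
    rcases h.mem_edges_iff.1 hg' with hg' | rfl | rfl
    · exact hR.exists_edge g' hg'.1
    · exact ⟨e, he, h.subset₁.trans hge⟩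
    · exact ⟨e, he, h.symm.subset₁.trans hge⟩
  exists_trail := by
    intro e he
    obtain ⟨x, y, l, hV, hT, hnd, hverts, hedges⟩ := hR.exists_trail e he
    have hyV : y ∈ G.verts :=
      hR.verts_subset (hV.symm ▸ mem_insert_of_mem x rfl : y ∈ e ∩ R.verts).2
    by_cases hg : g ∈ l.map Prod.fst
    · obtain ⟨l', hT', hperm, hl', h1, h2⟩ := h.exists_trail hT hnd hg
      have hperm' : (l'.map Prod.snd ++ [y]).Perm (w :: (l.map Prod.snd ++ [y])) :=
        hperm.append_right [y]
      refine ⟨x, y, l', hV, hT', ?_, ?_, ?_⟩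
      · rw [hperm'.nodup_iff, List.nodup_cons]
        exact ⟨fun hw => h.notMem (hT.mem_verts hyV hw), hnd⟩
      · intro z hz hze
        rw [hperm'.mem_iff, List.mem_cons]
        rw [h.verts_eq] at hz
        exact hz.imp_right fun hz => hverts z hz hze
      · intro g' hg' hge
        rcases h.mem_edges_iff.1 hg' with hg' | rfl | rfl
        · exact hl' g' (hedges g' hg'.1 hge) hg'.2
        · exact h1
        · exact h2
    -- Here `g` lies in an edge of `R` other than `e`; a common point of the two would be a vertex
    -- of `R`, whereas `w` is new.
    · have hwe : w ∉ e := by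
        intro hwe
        obtain ⟨e', he', hge'⟩ := hR.exists_edge g h.mem
        have hne : e ≠ e' := by
          rintro rfl
          exact hg (hedges g h.mem hge')
        exact h.notMem (hR.verts_subset (R.inter_subset e he e' he' hne ⟨hwe, hge' h.mem_w⟩))
      refine ⟨x, y, l, hV, h.trail_of_notMem hT hg, hnd, ?_, ?_⟩
      · intro z hz hze
        rw [h.verts_eq] at hz
        rcases hz with rfl | hz
        · exact absurd hze hwe
        · exact hverts z hz hze
      · intro g' hg' hge
        rcases h.mem_edges_iff.1 hg' with hg' | rfl | rfl
        · exact hedges g' hg'.1 hge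
        · exact absurd (hge h.arc₁.right_mem) hwe
        · exact absurd (hge h.arc₂.left_mem) hwe

theorem IsSubdivision.refines (h : IsSubdivision R G) : Refines R G := by
  induction h with
  | refl => exact Refines.refl
  | tail _ h ih =>
    obtain ⟨g, u, v, w, e₁, e₂, hs⟩ := h.exists_subdivides
    exact ih.subdivide hs

/-- Needed for lower bounds on `longestTwoPath`, since the supremum of an unbounded set of naturals
is 0 by convention. -/
theorem bddAbove_twoPath : BddAbove {n : ℕ | ∃ (u v : G.verts) (p : G.graph.Walk u v),
    p.IsPath ∧ (∀ w ∈ p.support, G.degree w = 2) ∧ p.support.length = n} := by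
  have := G.finite_verts.fintype
  refine ⟨Fintype.card G.verts, ?_⟩
  rintro n ⟨u, v, p, hp, -, rfl⟩
  exact (SimpleGraph.Walk.isPath_def p |>.1 hp).length_le_card

/-- The number of new vertices on an edge is at most the length of a longest path of vertices of
degree two. -/
theorem Refines.ncard_le_longestTwoPath (hR : Refines R G) {e : Set Plane} (he : e ∈ R.edges) :
    {z | z ∈ G.verts ∧ z ∉ R.verts ∧ z ∈ e}.ncard ≤ G.longestTwoPath := by
  obtain ⟨x, y, l, hV, hT, hnd, hverts, -⟩ := hR.exists_trail e he
  have hyR : y ∈ R.verts := (hV.symm ▸ mem_insert_of_mem x rfl : y ∈ e ∩ R.verts).2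
  have hxR : x ∈ R.verts := (hV.symm ▸ mem_insert x {y} : x ∈ e ∩ R.verts).2
  have hyV := hR.verts_subset hyR
  have hnd' : (l.map Prod.snd).Nodup := hnd.sublist (List.sublist_append_left _ _)
  obtain ⟨L, hL, hc⟩ := hT.exists_chain hnd'
  -- The list records first ends only, so `y` is absent, and passing to the tail drops `x`; what
  -- remains are the new vertices on `e`, in path order.
  have hsub : ∀ z ∈ G.verts, z ∉ R.verts → z ∈ e → z ∈ L.tail.map Subtype.val := by
    intro z hz hzR hze
    rw [List.map_tail, hL]
    have := hverts z hz hze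
    rw [List.mem_append, List.mem_singleton] at this
    have hzl := this.resolve_right (by rintro rfl; exact hzR hyR)
    cases hT with
    | nil => simp at hzl
    | cons _ _ _ _ =>
      simp only [List.map_cons, List.mem_cons, List.tail_cons] at hzl ⊢
      exact hzl.resolve_left (by rintro rfl; exact hzR hxR)
  have hdeg : ∀ a ∈ L.tail, G.degree a = 2 := by
    intro a ha
    refine hR.degree_eq a a.2 fun haR => ?_
    have h1 : (a : Plane) ∈ (l.map Prod.snd).tail := by
      rw [← hL, ← List.map_tail]
      exact List.mem_map_of_mem ha
    have h2 : (a : Plane) ∈ e ∩ R.verts := ⟨hT.mem_edge (List.mem_of_mem_tail h1), haR⟩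
    rw [hV] at h2
    rcases h2 with h2 | h2
    · cases hT with
      | nil => simp at h1
      | cons _ _ _ _ =>
        simp only [List.map_cons, List.tail_cons, List.nodup_cons] at h1 hnd'
        exact hnd'.1 (h2 ▸ h1)
    · rw [mem_singleton_iff] at h2
      rw [List.nodup_append] at hnd
      exact hnd.2.2 _ (List.mem_of_mem_tail h1) y (by simp) h2
  have hndL : L.tail.Nodup := by
    refine List.Nodup.tail (List.Nodup.of_map Subtype.val ?_)
    rwa [hL]
  have hle : {z | z ∈ G.verts ∧ z ∉ R.verts ∧ z ∈ e}.ncard ≤ L.tail.length := by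
    classical
    have h1 : {z | z ∈ G.verts ∧ z ∉ R.verts ∧ z ∈ e} ⊆
        ((L.tail.map Subtype.val).toFinset : Set Plane) := by
      rintro z ⟨hz, hzR, hze⟩
      rw [List.coe_toFinset]
      exact hsub z hz hzR hze
    refine (ncard_le_ncard h1 (Finset.finite_toSet _)).trans ?_
    rw [ncard_coe_finset]
    exact (List.toFinset_card_le _).trans (by simp)
  refine hle.trans ?_
  by_cases hne : L.tail = []
  · simp [hne]
  · refine le_csSup bddAbove_twoPath ⟨_, _, .ofSupport L.tail hne hc.tail, ?_, ?_, ?_⟩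
    · rw [SimpleGraph.Walk.isPath_def, SimpleGraph.Walk.support_ofSupport]
      exact hndL
    · rw [SimpleGraph.Walk.support_ofSupport]
      exact hdeg
    · rw [SimpleGraph.Walk.support_ofSupport]

end PlaneGraph

end

/-! ### Vizing's theorem for multigraphs, by fans and Kempe changes. -/

section

namespace EdgeColoring

/-- In a graph with maximum degree two, two different vertices with at most one neighbour are not
both reached by paths continuing the same edge. -/
theorem eq_of_isPath_of_avoid {V : Type*} {H : SimpleGraph V}
    (h2 : ∀ z p q r, H.Adj z p → H.Adj z q → H.Adj z r → p = q ∨ p = r ∨ q = r) {b c : V}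
    (hb : ∀ p q, H.Adj b p → H.Adj b q → p = q) (hc : ∀ p q, H.Adj c p → H.Adj c q → p = q)
    {v : V} (P : H.Walk v b) : ∀ (r : V) (Q : H.Walk v c), H.Adj v r → P.IsPath → Q.IsPath →
      r ∉ P.support → r ∉ Q.support → b = c := by
  induction P with
  | nil =>
    intro r Q hr _ hQ _ hrQ
    cases Q with
    | nil => rfl
    | cons hadj Q =>
      have := hb _ _ hr hadj
      subst this
      exact absurd (by simp) hrQ
  | @cons v x b hvx P ih =>
    intro r Q hr hP hQ hrP hrQ
    cases Q with
    | nil =>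
      have := hc _ _ hr hvx
      subst this
      exact absurd (by simp) hrP
    | @cons _ y _ hvy Q =>
      rw [SimpleGraph.Walk.cons_isPath_iff] at hP hQ
      -- Neither path returns to `r`, so both leave `v` by the same neighbour and the induction
      -- proceeds from there.
      rcases h2 v r x y hr hvx hvy with h | h | h
      · subst h
        exact absurd (by simp) hrP
      · subst h
        exact absurd (by simp) hrQ
      · subst h
        exact ih hb v Q hvx.symm hP.1 hQ.1 hP.2 hQ.2

/-- A component of a graph with maximum degree two has at most two vertices with at most one
neighbour. -/
theorem eq_of_reachable {V : Type*} {H : SimpleGraph V}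
    (h2 : ∀ z p q r, H.Adj z p → H.Adj z q → H.Adj z r → p = q ∨ p = r ∨ q = r) {a b c : V}
    (ha : ∀ p q, H.Adj a p → H.Adj a q → p = q)
    (hb : ∀ p q, H.Adj b p → H.Adj b q → p = q) (hc : ∀ p q, H.Adj c p → H.Adj c q → p = q)
    (hab : H.Reachable a b) (hac : H.Reachable a c) (nab : a ≠ b) (nac : a ≠ c) : b = c := by
  classical
  obtain ⟨P, hP⟩ := hab.exists_isPath
  obtain ⟨Q, hQ⟩ := hac.exists_isPath
  cases P with
  | nil => exact absurd rfl nab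
  | cons hx P =>
    cases Q with
    | nil => exact absurd rfl nac
    | cons hy Q =>
      obtain rfl := ha _ _ hx hy
      rw [SimpleGraph.Walk.cons_isPath_iff] at hP hQ
      exact eq_of_isPath_of_avoid h2 hb hc P a Q hx.symm hP.1 hQ.1 hP.2 hQ.2

variable {V E C : Type*}

/-- Edges with a common end other than `x` get different colours. -/
def ProperOff (ends : E → Sym2 V) (c : E → C) (x : E) : Prop :=
  ∀ e e', e ≠ x → e' ≠ x → e ≠ e' → ∀ v, v ∈ ends e → v ∈ ends e' → c e ≠ c e'

/-- Parallel edges are different elements of `E` with the same value of `ends`. A partial coloring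
with one uncolored edge `x` is a total function satisfying `ProperOff`, whose value at `x` is never
read. -/
def Proper (ends : E → Sym2 V) (c : E → C) : Prop :=
  ∀ e e', e ≠ e' → ∀ v, v ∈ ends e → v ∈ ends e' → c e ≠ c e'

/-- The colour `a` is not used by edges at `v` other than `x`. -/
def Missing (ends : E → Sym2 V) (c : E → C) (x : E) (v : V) (a : C) : Prop :=
  ∀ e, e ≠ x → v ∈ ends e → c e ≠ a

/-- A sequence of edges at `w` in which the colour of each edge is missing at the end of the
previous one. -/
def Fan (ends : E → Sym2 V) (c : E → C) (x : E) (w : V) : V → List E → V → Prop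
  | v, [], u => v = u
  | v, f :: l, u => ∃ v', f ≠ x ∧ ends f = s(w, v') ∧ Missing ends c x v (c f) ∧
      Fan ends c x w v' l u

variable {ends : E → Sym2 V} {c : E → C} {x : E} {w v u : V}

theorem fan_append {l₁ l₂ : List E} : Fan ends c x w v (l₁ ++ l₂) u ↔
    ∃ m, Fan ends c x w v l₁ m ∧ Fan ends c x w m l₂ u := by
  induction l₁ generalizing v with
  | nil => simp [Fan]
  | cons f l ih =>
    simp only [List.cons_append, Fan, ih]
    constructor
    · rintro ⟨v', h1, h2, h3, m, h4, h5⟩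
      exact ⟨m, ⟨v', h1, h2, h3, h4⟩, h5⟩
    · rintro ⟨m, ⟨v', h1, h2, h3, h4⟩, h5⟩
      exact ⟨v', h1, h2, h3, m, h4, h5⟩

/-- The condition at an edge may use the initial segment of the fan leading to it. The Kempe
argument needs this to apply its induction to a shorter fan. -/
theorem Fan.transfer {c' : E → C} {x' : E} {l : List E} (h : Fan ends c x w v l u)
    (ht : ∀ l₁ g l₂ m, l = l₁ ++ g :: l₂ → Fan ends c x w v l₁ m → g ≠ x → w ∈ ends g →
      Missing ends c x m (c g) → g ≠ x' ∧ Missing ends c' x' m (c' g)) :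
    Fan ends c' x' w v l u := by
  induction l generalizing v with
  | nil => exact h
  | cons f l ih =>
    obtain ⟨v', h1, h2, h3, h4⟩ := h
    obtain ⟨h5, h6⟩ := ht [] f l v rfl rfl h1 (h2 ▸ Sym2.mem_mk_left w v') h3
    refine ⟨v', h5, h2, h6, ih h4 fun l₁ g l₂ m hl hF => ?_⟩
    exact ht (f :: l₁) g l₂ m (by rw [hl]; rfl) ⟨v', h1, h2, h3, hF⟩

theorem Fan.ne (hloop : ∀ e, ¬ (ends e).IsDiag) {l : List E} (h : Fan ends c x w v l u)
    (hv : v ≠ w) : u ≠ w := by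
  induction l generalizing v with
  | nil => exact h ▸ hv
  | cons f l ih =>
    obtain ⟨v', h1, h2, h3, h4⟩ := h
    refine ih h4 ?_
    rintro rfl
    exact hloop f (by rw [h2]; simp)

/-- A colour missing at both ends of the uncoloured edge, or movable there along a fan, completes
the colouring. -/
theorem exists_proper_of_missing {l : List E} {a : C} (hx : ends x = s(w, v))
    (hc : ProperOff ends c x) (hl : (x :: l).Nodup) (hF : Fan ends c x w v l u)
    (hw : Missing ends c x w a) (hu : Missing ends c x u a) : ∃ c' : E → C, Proper ends c' := by
  classical
  induction l generalizing c x v with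
  | nil =>
    obtain rfl : v = u := hF
    refine ⟨Function.update c x a, ?_⟩
    have key : ∀ e, e ≠ x → ∀ z, z ∈ ends x → z ∈ ends e → c e ≠ a := by
      intro e he z hz hze
      rw [hx, Sym2.mem_iff] at hz
      rcases hz with rfl | rfl
      · exact hw e he hze
      · exact hu e he hze
    intro e e' hne z hz hz'
    by_cases h1 : e = x
    · subst h1
      rw [Function.update_self, Function.update_of_ne hne.symm]
      exact (key e' hne.symm z hz hz').symm
    · by_cases h2 : e' = x
      · subst h2
        rw [Function.update_self, Function.update_of_ne hne]
        exact key e hne z hz' hz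
      · rw [Function.update_of_ne h1, Function.update_of_ne h2]
        exact hc e e' h1 h2 hne z hz hz'
  | cons f l ih =>
    obtain ⟨v', hfx, hf, hm, hF⟩ := hF
    have hwf : w ∈ ends f := hf ▸ Sym2.mem_mk_left w v'
    have hfl : (f :: l).Nodup := (List.nodup_cons.1 hl).2
    have hxl : x ∉ f :: l := (List.nodup_cons.1 hl).1
    have key : ∀ e, e ≠ x → e ≠ f → ∀ z, z ∈ ends x → z ∈ ends e → c f ≠ c e := by
      intro e he hef z hz hze
      rw [hx, Sym2.mem_iff] at hz
      rcases hz with rfl | rfl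
      · exact hc f e hfx he hef.symm z hwf hze
      · exact (hm e he hze).symm
    have hup : ∀ z b, Missing ends c x z b → c f ≠ b →
        Missing ends (Function.update c x (c f)) f z b := by
      intro z b hz hfb e hef hze
      by_cases he : e = x
      · subst he
        rwa [Function.update_self]
      · rw [Function.update_of_ne he]
        exact hz e he hze
    -- The fan is shifted by one: `x` takes the color of `f`, which becomes the uncolored edge.
    refine ih (c := Function.update c x (c f)) (x := f) hf ?_ hfl (hF.transfer ?_) ?_ ?_
    · intro e e' he he' hne z hz hz'
      by_cases h1 : e = x
      · subst h1
        rw [Function.update_self, Function.update_of_ne hne.symm]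
        exact key e' hne.symm he' z hz hz'
      · by_cases h2 : e' = x
        · subst h2
          rw [Function.update_self, Function.update_of_ne hne]
          exact (key e hne he z hz' hz).symm
        · rw [Function.update_of_ne h1, Function.update_of_ne h2]
          exact hc e e' h1 h2 hne z hz hz'
    · intro l₁ g l₂ m hlg _ hgx hwg hmg
      have hgl : g ∈ l := by simp [hlg]
      have hgf : g ≠ f := by
        rintro rfl
        exact (List.nodup_cons.1 hfl).1 hgl
      rw [Function.update_of_ne hgx]
      exact ⟨hgf, hup m _ hmg (hc f g hfx hgx hgf.symm w hwf hwg)⟩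
    · exact hup w a hw (hw f hfx hwf)
    · exact hup u a hu (hw f hfx hwf)

/-- The graph formed by the edges other than `x` coloured `α` or `β`. -/
def twoColored (ends : E → Sym2 V) (c : E → C) (x : E) (α β : C) : SimpleGraph V where
  Adj p q := p ≠ q ∧ ∃ e, e ≠ x ∧ (c e = α ∨ c e = β) ∧ ends e = s(p, q)
  symm := ⟨fun _ _ ⟨h, e, h1, h2, h3⟩ => ⟨h.symm, e, h1, h2, h3.trans Sym2.eq_swap⟩⟩
  loopless := ⟨fun _ h => h.1 rfl⟩

/-- A Kempe change. -/
theorem exists_swap [DecidableEq C] (hc : ProperOff ends c x) (α β : C) (P : Set V)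
    (hP : ∀ p q, (twoColored ends c x α β).Adj p q → p ∈ P → q ∈ P) :
    ∃ c' : E → C, ProperOff ends c' x ∧
      (∀ e, e ≠ x → ∀ z ∈ ends e, z ∈ P → c' e = Equiv.swap α β (c e)) ∧
      ∀ e, e ≠ x → ∀ z ∈ ends e, z ∉ P → c' e = c e := by
  classical
  -- `P` is closed along edges colored `α` or `β`, so an edge with just one end in `P` has a color
  -- fixed by the swap.
  have h1 : ∀ e, e ≠ x → ∀ z ∈ ends e, z ∉ P → (∃ z ∈ ends e, z ∈ P) →
      Equiv.swap α β (c e) = c e := by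
    rintro e he z hz hzP ⟨z', hz', hzP'⟩
    by_cases hcol : c e = α ∨ c e = β
    · refine absurd (hP z' z ⟨?_, e, he, hcol, ?_⟩ hzP') hzP
      · rintro rfl
        exact hzP hzP'
      · exact (Sym2.mem_and_mem_iff (by rintro rfl; exact hzP hzP')).1 ⟨hz', hz⟩
    · push Not at hcol
      exact Equiv.swap_apply_of_ne_of_ne hcol.1 hcol.2
  let c' : E → C := fun e => if ∃ z ∈ ends e, z ∈ P then Equiv.swap α β (c e) else c e
  have hin : ∀ e, e ≠ x → ∀ z ∈ ends e, z ∈ P → c' e = Equiv.swap α β (c e) :=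
    fun e _ z hz hzP => if_pos ⟨z, hz, hzP⟩
  have hout : ∀ e, e ≠ x → ∀ z ∈ ends e, z ∉ P → c' e = c e := by
    intro e he z hz hzP
    by_cases h : ∃ z ∈ ends e, z ∈ P
    · exact (if_pos h).trans (h1 e he z hz hzP h)
    · exact if_neg h
  refine ⟨c', ?_, hin, hout⟩
  intro e e' he he' hne z hz hz'
  have := hc e e' he he' hne z hz hz'
  by_cases hzP : z ∈ P
  · rw [hin e he z hz hzP, hin e' he' z hz' hzP]
    exact fun h => this ((Equiv.swap α β).injective h)
  · rwa [hout e he z hz hzP, hout e' he' z hz' hzP]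

/-- Otherwise swapping `α` and `β` on the component of `u` frees `α` at `u` and leaves the edges at
`w` unchanged. The fan could break only where an edge colored `β` follows a vertex `m` of that
component; but `β` is missing at `m`, so by induction on the length `m` is reachable from `w`. The
fan thus survives, and `α` is missing at both `w` and `u`. -/
theorem reachable_of_fan (hno : ¬ ∃ c' : E → C, Proper ends c') {α β : C}
    (hx : ends x = s(w, v)) (hc : ProperOff ends c x) (hw : Missing ends c x w α) (n : ℕ) :
    ∀ (l : List E) (u : V), l.length = n → (x :: l).Nodup → Fan ends c x w v l u →
      Missing ends c x u β → (twoColored ends c x α β).Reachable w u := by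
  classical
  induction n using Nat.strong_induction_on with
  | _ n ih =>
  intro l u hn hl hF hu
  by_contra hnr
  set H := twoColored ends c x α β with hH
  obtain ⟨c', hc', hin, hout⟩ := exists_swap hc α β {z | H.Reachable u z}
    (fun p q hpq hp => hp.trans hpq.reachable)
  have hwP : w ∉ {z | H.Reachable u z} := fun h => hnr h.symm
  refine hno (exists_proper_of_missing (a := α) (u := u) (l := l) hx hc' hl (hF.transfer ?_) ?_ ?_)
  · intro l₁ g l₂ m hlg hF₁ hgx hwg hm
    refine ⟨hgx, ?_⟩
    rw [hout g hgx w hwg hwP]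
    intro e he hme
    have hgα : c g ≠ α := hw g hgx hwg
    by_cases hmP : m ∈ {z | H.Reachable u z}
    · by_cases hgβ : c g = β
      · exfalso
        have hsub : (x :: l₁).Nodup := by
          refine List.Nodup.sublist ?_ hl
          rw [hlg]
          exact List.Sublist.cons_cons _ (List.sublist_append_left _ _)
        have := ih l₁.length (by rw [← hn, hlg]; simp) l₁ m rfl hsub hF₁ (hgβ ▸ hm)
        exact hnr (this.trans hmP.symm)
      · rw [hin e he m hme hmP]
        intro h
        have h2 : c e = c g := by
          have h3 := congrArg (Equiv.swap α β) h
          rwa [Equiv.swap_apply_self, Equiv.swap_apply_of_ne_of_ne hgα hgβ] at h3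
        exact hm e he hme h2
    · rw [hout e he m hme hmP]
      exact hm e he hme
  · intro e he hwe
    rw [hout e he w hwe hwP]
    exact hw e he hwe
  · intro e he hue
    rw [hin e he u hue (SimpleGraph.Reachable.refl u)]
    intro h
    have h3 := congrArg (Equiv.swap α β) h
    rw [Equiv.swap_apply_self, Equiv.swap_apply_left] at h3
    exact hu e he hue h3

/-- `w`, `u` and `u'` lie in one component of the `α`/`β` graph, which has maximum degree two. Each
misses one of the two colors and so has at most one neighbour there, and `w` differs from the other
two. -/
theorem eq_of_missing (hloop : ∀ e, ¬ (ends e).IsDiag) (hno : ¬ ∃ c' : E → C, Proper ends c')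
    {α β : C} (hx : ends x = s(w, v)) (hc : ProperOff ends c x) (hw : Missing ends c x w α)
    {l l' : List E} {u' : V} (hl : (x :: l).Nodup) (hl' : (x :: l').Nodup)
    (hF : Fan ends c x w v l u) (hF' : Fan ends c x w v l' u') (hu : Missing ends c x u β)
    (hu' : Missing ends c x u' β) : u = u' := by
  have hr := reachable_of_fan hno hx hc hw l.length l u rfl hl hF hu
  have hr' := reachable_of_fan hno hx hc hw l'.length l' u' rfl hl' hF' hu'
  have hvw : v ≠ w := by
    rintro rfl
    exact hloop x (by rw [hx]; simp)
  have hsame : ∀ z p q e e', e ≠ x → e' ≠ x → ends e = s(z, p) → ends e' = s(z, q) →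
      c e = c e' → p = q := by
    intro z p q e e' he he' h1 h2 h3
    have : e = e' := by
      by_contra hne
      exact hc e e' he he' hne z (h1 ▸ Sym2.mem_mk_left _ _) (h2 ▸ Sym2.mem_mk_left _ _) h3
    subst this
    exact Sym2.congr_right.1 (h1.symm.trans h2)
  refine eq_of_reachable ?_ ?_ ?_ ?_ hr hr' (hF.ne hloop hvw).symm (hF'.ne hloop hvw).symm
  · rintro z p q r ⟨-, e, he, hce, hp⟩ ⟨-, e', he', hce', hq⟩ ⟨-, e'', he'', hce'', hr⟩
    have h1 := hsame z p q e e' he he' hp hq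
    have h2 := hsame z p r e e'' he he'' hp hr
    have h3 := hsame z q r e' e'' he' he'' hq hr
    rcases hce with h | h <;> rcases hce' with h' | h' <;> rcases hce'' with h'' | h'' <;>
      simp_all
  · rintro p q ⟨-, e, he, hce, hp⟩ ⟨-, e', he', hce', hq⟩
    have m1 := hw e he (hp ▸ Sym2.mem_mk_left _ _)
    have m2 := hw e' he' (hq ▸ Sym2.mem_mk_left _ _)
    exact hsame _ p q e e' he he' hp hq
      ((hce.resolve_left m1).trans (hce'.resolve_left m2).symm)
  · rintro p q ⟨-, e, he, hce, hp⟩ ⟨-, e', he', hce', hq⟩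
    have m1 := hu e he (hp ▸ Sym2.mem_mk_left _ _)
    have m2 := hu e' he' (hq ▸ Sym2.mem_mk_left _ _)
    exact hsame _ p q e e' he he' hp hq
      ((hce.resolve_right m1).trans (hce'.resolve_right m2).symm)
  · rintro p q ⟨-, e, he, hce, hp⟩ ⟨-, e', he', hce', hq⟩
    have m1 := hu' e he (hp ▸ Sym2.mem_mk_left _ _)
    have m2 := hu' e' he' (hq ▸ Sym2.mem_mk_left _ _)
    exact hsame _ p q e e' he he' hp hq
      ((hce.resolve_right m1).trans (hce'.resolve_right m2).symm)

-- If the coloring cannot be completed, count at `w` over the set `U` of ends of fans. The sets of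
-- missing colors are disjoint over `U`, and each such color appears on an edge from `w` back into
-- `U`. Hence these sets have in total at most as many elements as there are colored edges from `w`
-- to `U`. But each vertex misses at least `μ` colors and receives at most `μ` of these edges,
-- strictly fewer at `v` because `x` is uncolored.
open Classical in
theorem exists_proper_of_properOff [Fintype E] [Fintype C] (hloop : ∀ e, ¬ (ends e).IsDiag)
    {D μ : ℕ} (hC : D + μ ≤ Fintype.card C)
    (hdeg : ∀ v, (Finset.univ.filter fun e => v ∈ ends e).card ≤ D)
    (hmul : ∀ u v, (Finset.univ.filter fun e => ends e = s(u, v)).card ≤ μ)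
    (hc : ProperOff ends c x) : ∃ c' : E → C, Proper ends c' := by
  by_contra hno
  obtain ⟨w, v, hx⟩ : ∃ w v, ends x = s(w, v) := by
    induction h : ends x using Sym2.ind with
    | _ w v => exact ⟨w, v, rfl⟩
  let miss : V → Finset C := fun u => Finset.univ.filter fun a => Missing ends c x u a
  have hmiss : ∀ u, μ ≤ (miss u).card := by
    intro u
    have h1 : Finset.univ ⊆ miss u ∪ (Finset.univ.filter fun e => u ∈ ends e).image c := by
      intro a _
      by_cases ha : Missing ends c x u a
      · exact Finset.mem_union_left _ (by simpa [miss] using ha)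
      · simp only [Missing, not_forall, not_not] at ha
        obtain ⟨e, -, hue, hea⟩ := ha
        exact Finset.mem_union_right _ (Finset.mem_image.2 ⟨e, by simpa using hue, hea⟩)
    have h2 := (Finset.card_le_card h1).trans (Finset.card_union_le _ _)
    have h3 := Finset.card_image_le (s := Finset.univ.filter fun e => u ∈ ends e) (f := c)
    have h4 := hdeg u
    rw [Finset.card_univ] at h2
    omega
  let par : V → Finset E := fun u => Finset.univ.filter fun e => e ≠ x ∧ ends e = s(w, u)
  have hpar : ∀ u, (par u).card ≤ μ := fun u => le_trans
    (Finset.card_le_card fun e he => by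
      simp only [par, Finset.mem_filter, Finset.mem_univ, true_and] at he ⊢
      exact he.2) (hmul w u)
  have hparv : (par v).card < μ := lt_of_lt_of_le
    (Finset.card_lt_card (by
      refine Finset.ssubset_iff.2 ⟨x, by simp [par], fun e he => ?_⟩
      rcases Finset.mem_insert.1 he with rfl | he
      · simpa using hx
      · simp only [par, Finset.mem_filter, Finset.mem_univ, true_and] at he ⊢
        exact he.2)) (hmul w v)
  obtain ⟨α, hα⟩ : ∃ α, Missing ends c x w α := by
    obtain ⟨α, hα⟩ := Finset.card_pos.1 (lt_of_lt_of_le (by omega) (hmiss w))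
    exact ⟨α, by simpa [miss] using hα⟩
  let U : Set V := {u | ∃ l, (x :: l).Nodup ∧ Fan ends c x w v l u}
  have hvU : v ∈ U := ⟨[], by simp, rfl⟩
  have hUfin : U.Finite := by
    have h1 : U ⊆ ⋃ e : E, {u | u ∈ ends e} := by
      rintro u ⟨l, -, hF⟩
      rw [Set.mem_iUnion]
      rcases List.eq_nil_or_concat l with rfl | ⟨l', f, rfl⟩
      · obtain rfl : v = u := hF
        exact ⟨x, by rw [Set.mem_ofPred_eq, hx]; exact Sym2.mem_mk_right _ _⟩
      · obtain ⟨m, -, v', -, hf, -, rfl⟩ := fan_append.1 (by simpa using hF)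
        exact ⟨f, by rw [Set.mem_ofPred_eq, hf]; exact Sym2.mem_mk_right _ _⟩
    refine Set.Finite.subset (Set.finite_iUnion fun e => ?_) h1
    induction ends e using Sym2.ind with
    | _ p q =>
      refine (Set.toFinite {p, q}).subset fun u hu => ?_
      simpa using hu
  have hstep : ∀ u ∈ U, ∀ a, Missing ends c x u a → ∃ u' ∈ U, ∃ g, g ∈ par u' ∧ c g = a := by
    rintro u ⟨l, hl, hF⟩ a ha
    have hwa : ¬ Missing ends c x w a := fun hwa =>
      hno (exists_proper_of_missing hx hc hl hF hwa ha)
    simp only [Missing, not_forall, not_not] at hwa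
    obtain ⟨g, hgx, hwg, hga⟩ := hwa
    obtain ⟨u', hu'⟩ := Sym2.mem_iff_exists.1 hwg
    refine ⟨u', ?_, g, by simp [par, hgx, hu'], hga⟩
    -- If `g` is already in the fan, the fan is cut just after `g`; otherwise `g` extends it.
    by_cases hgl : g ∈ l
    · obtain ⟨l₁, l₂, rfl⟩ := List.append_of_mem hgl
      obtain ⟨m, h1, v', h2, h3, h4, -⟩ := fan_append.1 hF
      obtain rfl : u' = v' := Sym2.congr_right.1 (hu'.symm.trans h3)
      refine ⟨l₁ ++ [g], ?_, fan_append.2 ⟨m, h1, u', h2, h3, h4, rfl⟩⟩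
      refine hl.sublist (List.Sublist.cons_cons _ ?_)
      exact List.Sublist.append_left (by simp) _
    · refine ⟨l ++ [g], ?_, fan_append.2 ⟨u, hF, u', hgx, hu', hga ▸ ha, rfl⟩⟩
      simp only [List.nodup_cons, List.nodup_append, List.mem_append, List.mem_singleton] at hl ⊢
      refine ⟨?_, hl.2, by simp, ?_⟩
      · rintro (h | h)
        · exact hl.1 h
        · exact hgx h.symm
      · rintro y hy z rfl rfl
        exact hgl hy
  have hdisj : (hUfin.toFinset : Set V).PairwiseDisjoint miss := by
    intro u hu u' hu' hne
    rw [Function.onFun, Finset.disjoint_left]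
    intro a ha ha'
    simp only [Set.Finite.coe_toFinset] at hu hu'
    obtain ⟨l, hl, hF⟩ := hu
    obtain ⟨l', hl', hF'⟩ := hu'
    exact hne (eq_of_missing hloop hno hx hc hα hl hl' hF hF' (by simpa [miss] using ha)
      (by simpa [miss] using ha'))
  have hcard : ∑ u ∈ hUfin.toFinset, (miss u).card ≤ ∑ u ∈ hUfin.toFinset, (par u).card := by
    rw [← Finset.card_biUnion hdisj]
    calc (hUfin.toFinset.biUnion miss).card
        ≤ ((hUfin.toFinset.biUnion par).image c).card := by
          refine Finset.card_le_card fun a ha => ?_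
          obtain ⟨u, hu, hau⟩ := Finset.mem_biUnion.1 ha
          obtain ⟨u', hu', g, hg, hga⟩ := hstep u (by simpa using hu) a (by simpa [miss] using hau)
          exact Finset.mem_image.2 ⟨g, Finset.mem_biUnion.2 ⟨u', by simpa using hu', hg⟩, hga⟩
      _ ≤ (hUfin.toFinset.biUnion par).card := Finset.card_image_le
      _ ≤ _ := Finset.card_biUnion_le
  refine absurd hcard (not_le.2 (Finset.sum_lt_sum (fun u _ => (hpar u).trans (hmiss u))
    ⟨v, by simpa using hvU, hparv.trans_le (hmiss v)⟩))

-- Induction on the number of edges, deleting one edge at a time; the types are quantified inside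
-- because the edge type shrinks.
open Classical in
theorem exists_proper_of_card_eq (n : ℕ) : ∀ {V E : Type*} [Fintype E] {ends : E → Sym2 V},
    Fintype.card E = n → (∀ e, ¬ (ends e).IsDiag) → ∀ {D μ : ℕ},
    (∀ v, (Finset.univ.filter fun e => v ∈ ends e).card ≤ D) →
    (∀ u v, (Finset.univ.filter fun e => ends e = s(u, v)).card ≤ μ) →
    ∃ c : E → Fin (D + μ), Proper ends c := by
  induction n with
  | zero =>
    intro V E _ ends hE _ D μ _ _
    have := Fintype.card_eq_zero_iff.1 hE
    exact ⟨fun e => isEmptyElim e, fun e => isEmptyElim e⟩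
  | succ n ih =>
    intro V E _ ends hE hloop D μ hdeg hmul
    have : Nonempty E := Fintype.card_pos_iff.1 (by omega)
    obtain ⟨x⟩ := this
    have hsub : ∀ p : E → Prop, (Finset.univ.filter fun e : {e : E // e ≠ x} => p e).card ≤
        (Finset.univ.filter p).card := by
      intro p
      refine Finset.card_le_card_of_injOn Subtype.val (fun e he => ?_)
        Subtype.val_injective.injOn
      simpa using he
    have hcard : Fintype.card {e : E // e ≠ x} = n := by
      rw [Fintype.card_subtype_compl, Fintype.card_subtype_eq, hE]
      rfl
    obtain ⟨c₀, hc₀⟩ := ih (ends := fun e : {e : E // e ≠ x} => ends e) hcard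
      (fun e => hloop e) (D := D) (μ := μ) (fun v => by
        refine le_trans ?_ (hdeg v)
        convert! hsub fun e => v ∈ ends e)
      (fun u v => by
        refine le_trans ?_ (hmul u v)
        convert! hsub fun e => ends e = s(u, v))
    have hpos : 0 < D + μ := by
      obtain ⟨v, hv⟩ : ∃ v, v ∈ ends x := ⟨_, Sym2.out_fst_mem _⟩
      have h1 : 0 < (Finset.univ.filter fun e => v ∈ ends e).card :=
        Finset.card_pos.2 ⟨x, by simpa using hv⟩
      have := hdeg v
      omega
    refine exists_proper_of_properOff (x := x)
      (c := fun e => if h : e = x then ⟨0, hpos⟩ else c₀ ⟨e, h⟩) hloop (by simp) hdeg hmul ?_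
    intro e e' he he' hne z hz hz'
    simp only [he, he', dite_false]
    exact hc₀ ⟨e, he⟩ ⟨e', he'⟩ (fun h => hne (congrArg Subtype.val h)) z hz hz'

/-- Vizing's theorem for multigraphs. -/
theorem exists_proper [Finite E] (hloop : ∀ e, ¬ (ends e).IsDiag) {D μ : ℕ}
    (hdeg : ∀ v, {e | v ∈ ends e}.ncard ≤ D) (hmul : ∀ u v, {e | ends e = s(u, v)}.ncard ≤ μ) :
    ∃ c : E → Fin (D + μ), Proper ends c := by
  classical
  have := Fintype.ofFinite E
  refine exists_proper_of_card_eq (Fintype.card E) rfl hloop (fun v => ?_) fun u v => ?_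
  · rw [← Set.ncard_coe_finset]
    simpa using hdeg v
  · rw [← Set.ncard_coe_finset]
    simpa using hmul u v

end EdgeColoring

end

/-! ### The dual multigraph and the final count. -/

section

open Set

namespace PlaneGraph

variable {R G : PlaneGraph}

theorem Refines.faces_eq (hR : Refines R G) : G.faces = R.faces := by
  simp only [faces, hR.support_eq]

theorem faceDegree_le_maxFaceDegree {f : Set Plane} (hf : f ∈ G.faces) :
    G.faceDegree f ≤ G.maxFaceDegree := by
  refine le_csSup ⟨G.verts.ncard, ?_⟩ ⟨f, hf, rfl⟩
  rintro n ⟨f, -, rfl⟩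
  exact ncard_le_ncard inter_subset_left G.finite_verts

/-- A cyclic coloring with as few colors as possible. -/
theorem exists_isCyclicColoring :
    ∃ c : G.verts → Fin G.cyclicChromaticNumber, G.IsCyclicColoring c := by
  have := G.finite_verts.fintype
  exact Nat.sInf_mem (s := {k : ℕ | ∃ c : G.verts → Fin k, G.IsCyclicColoring c})
    ⟨Fintype.card G.verts, Fintype.equivFin G.verts,
      fun _ _ u v _ _ huv h => huv ((Fintype.equivFin G.verts).injective h)⟩

theorem Refines.exists_edge_mem (hR : Refines R G) {z : Plane} (hz : z ∈ G.verts)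
    (hzR : z ∉ R.verts) : ∃ e ∈ R.edges, z ∈ e := by
  have : z ∈ R.support := hR.support_eq ▸ Or.inl hz
  exact this.resolve_left hzR

/-- The dual edge of a subdivision vertex, completed to a pair by dummy vertices. -/
theorem Refines.exists_dual_edge (hR : Refines R G) {ι : Type} (i : ι) {z : Plane}
    (hz : z ∈ G.verts) (hzR : z ∉ R.verts) : ∃ s : Sym2 (Set Plane ⊕ ι × Bool), ¬ s.IsDiag ∧
      (∀ f, Sum.inl f ∈ s ↔ f ∈ R.faces ∧ z ∈ frontier f) ∧
      ∀ j b, Sum.inr (j, b) ∈ s → j = i := by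
  obtain ⟨e, he, hze⟩ := hR.exists_edge_mem hz hzR
  -- Only the upper bound of two faces is needed. Absent faces are replaced by dummy vertices
  -- private to `i`, which creates neither loops nor extra parallel edges.
  by_cases h₁ : ∃ f ∈ R.faces, z ∈ frontier f
  · obtain ⟨f₁, hf₁, hz₁⟩ := h₁
    by_cases h₂ : ∃ f ∈ R.faces, z ∈ frontier f ∧ f ≠ f₁
    · obtain ⟨f₂, hf₂, hz₂, hne⟩ := h₂
      refine ⟨s(.inl f₁, .inl f₂), by simpa using hne.symm, fun f => ?_, by simp⟩
      simp only [Sym2.mem_iff, Sum.inl.injEq]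
      constructor
      · rintro (rfl | rfl)
        · exact ⟨hf₁, hz₁⟩
        · exact ⟨hf₂, hz₂⟩
      · rintro ⟨hf, hzf⟩
        rcases eq_of_mem_frontier_three he hf hf₁ hf₂ hze hzR hzf hz₁ hz₂ with h | h | h
        · exact Or.inl h
        · exact Or.inr h
        · exact absurd h.symm hne
    · push Not at h₂
      refine ⟨s(.inl f₁, .inr (i, false)), by simp, fun f => ?_, fun j b h => ?_⟩
      · simp only [Sym2.mem_iff, Sum.inl.injEq, reduceCtorEq, or_false]
        constructor
        · rintro rfl
          exact ⟨hf₁, hz₁⟩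
        · rintro ⟨hf, hzf⟩
          exact h₂ f hf hzf
      · simp only [Sym2.mem_iff, reduceCtorEq, Sum.inr.injEq, Prod.mk.injEq, false_or] at h
        exact h.1
  · refine ⟨s(.inr (i, false), .inr (i, true)), by simp, fun f => ?_, fun j b h => ?_⟩
    · simp only [Sym2.mem_iff, reduceCtorEq, or_false, false_iff]
      rintro ⟨hf, hzf⟩
      exact h₁ ⟨f, hf, hzf⟩
    · simp only [Sym2.mem_iff, Sum.inr.injEq, Prod.mk.injEq] at h
      rcases h with h | h <;> exact h.1

theorem Refines.one_le_longestTwoPath (hR : Refines R G) {z : Plane} (hz : z ∈ G.verts)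
    (hzR : z ∉ R.verts) : 1 ≤ G.longestTwoPath := by
  obtain ⟨e, he, hze⟩ := hR.exists_edge_mem hz hzR
  refine le_trans ?_ (hR.ncard_le_longestTwoPath he)
  rw [Nat.one_le_iff_ne_zero, ne_eq, ncard_eq_zero (G.finite_verts.subset fun z hz => hz.1)]
  exact Nonempty.ne_empty ⟨z, hz, hzR, hze⟩

/-- The degree of the face in `G` also counts its vertices in `R`, of which there are at least
three. The additive form yields `3 ≤ G.maxFaceDegree` as well, so later truncated subtractions are
genuine. -/
theorem Refines.ncard_new_add_three_le (hR : Refines R G) (hsimple : R.IsSimple)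
    (h4 : 4 ≤ R.verts.ncard) {f : Set Plane} (hf : f ∈ R.faces) :
    {z | z ∈ G.verts ∧ z ∉ R.verts ∧ z ∈ frontier f}.ncard + 3 ≤ G.maxFaceDegree := by
  have h1 := three_le_faceDegree hsimple h4 hf
  have h2 := faceDegree_le_maxFaceDegree (hR.faces_eq ▸ hf)
  have h3 : {z | z ∈ G.verts ∧ z ∉ R.verts ∧ z ∈ frontier f}.ncard + R.faceDegree f ≤
      G.faceDegree f := by
    have hfin : {z | z ∈ G.verts ∧ z ∉ R.verts ∧ z ∈ frontier f}.Finite :=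
      G.finite_verts.subset fun z hz => hz.1
    have hfin' : (R.faceVerts f).Finite := R.finite_verts.subset inter_subset_left
    rw [faceDegree, faceDegree, ← ncard_union_eq ?_ hfin hfin']
    · refine ncard_le_ncard ?_ (G.finite_verts.subset inter_subset_left)
      rintro z (hz | hz)
      · exact ⟨hz.1, hz.2.2⟩
      · exact ⟨hR.verts_subset hz.1, hz.2⟩
    · exact disjoint_left.2 fun z hz hz' => hz.2.1 hz'.1
  omega

/-- The subdivision vertices can be colored using Vizing's theorem in the dual. -/
theorem Refines.exists_coloring_new (hR : Refines R G) (hsimple : R.IsSimple)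
    (hconn : R.IsThreeConnected) :
    ∃ c : {z // z ∈ G.verts ∧ z ∉ R.verts} → Fin (G.maxFaceDegree - 3 + G.longestTwoPath),
      ∀ f ∈ R.faces, ∀ z z' : {z // z ∈ G.verts ∧ z ∉ R.verts}, (z : Plane) ∈ frontier f →
        (z' : Plane) ∈ frontier f → z ≠ z' → c z ≠ c z' := by
  classical
  let W : Type := {z // z ∈ G.verts ∧ z ∉ R.verts}
  have : Finite W := (G.finite_verts.subset (fun z hz => hz.1 :
    {z | z ∈ G.verts ∧ z ∉ R.verts} ⊆ G.verts)).to_subtype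
  have hfin : ∀ p : Plane → Prop, {z | z ∈ G.verts ∧ z ∉ R.verts ∧ p z}.Finite := fun p =>
    G.finite_verts.subset fun z hz => hz.1
  have hcard : ∀ (p : Plane → Prop) (q : Set W), (∀ z ∈ q, p z) →
      q.ncard ≤ {z | z ∈ G.verts ∧ z ∉ R.verts ∧ p z}.ncard := fun p q hpq =>
    ncard_le_ncard_of_injOn Subtype.val (fun z hz => ⟨z.2.1, z.2.2, hpq z hz⟩)
      Subtype.val_injective.injOn (hfin p)
  -- The dummy vertices have degree up to one, so Vizing's theorem needs a positive degree bound.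
  -- When the bound is 0, no new vertex lies on a face boundary and any coloring will do.
  rcases Nat.eq_zero_or_pos (G.maxFaceDegree - 3) with h0 | hpos
  · by_cases hW : Nonempty W
    · obtain ⟨z₀⟩ := hW
      have ht := hR.one_le_longestTwoPath z₀.2.1 z₀.2.2
      refine ⟨fun _ => ⟨0, by omega⟩, fun f hf z z' hz _ _ => ?_⟩
      have h1 := hR.ncard_new_add_three_le hsimple hconn.1 hf
      have h2 : {z | z ∈ G.verts ∧ z ∉ R.verts ∧ z ∈ frontier f}.ncard ≠ 0 :=
        ncard_ne_zero_of_mem ⟨z.2.1, z.2.2, hz⟩ (hfin _)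
      omega
    · exact ⟨fun z => absurd ⟨z⟩ hW, fun f hf z => absurd ⟨z⟩ hW⟩
  have hdual := fun z : W => hR.exists_dual_edge z z.2.1 z.2.2
  choose ends hloop hface hdummy using hdual
  have hone : ∀ (j : W) (q : Set W), (∀ z ∈ q, j = z) → q.ncard ≤ 1 := fun j q hq =>
    (ncard_le_one_iff (toFinite q)).2 fun ha hb => (hq _ ha).symm.trans (hq _ hb)
  suffices h : ∃ c : W → Fin (G.maxFaceDegree - 3 + G.longestTwoPath),
      EdgeColoring.Proper ends c by
    obtain ⟨c, hc⟩ := h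
    exact ⟨c, fun f hf z z' hz hz' hne =>
      hc z z' hne (.inl f) ((hface z f).2 ⟨hf, hz⟩) ((hface z' f).2 ⟨hf, hz'⟩)⟩
  refine EdgeColoring.exists_proper hloop ?_ ?_
  · rintro (f | ⟨j, b⟩)
    · by_cases hf : f ∈ R.faces
      · exact (hcard (fun z => z ∈ frontier f) _ fun z hz => ((hface z f).1 hz).2).trans
          (Nat.le_sub_of_add_le (hR.ncard_new_add_three_le hsimple hconn.1 hf))
      · have hempty : {z | Sum.inl f ∈ ends z} = ∅ :=
          eq_empty_of_forall_notMem fun z hz => hf ((hface z f).1 hz).1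
        rw [hempty, ncard_empty]
        exact Nat.zero_le _
    · exact (hone j _ fun z hz => hdummy z j b hz).trans hpos
  · intro p q
    rcases eq_empty_or_nonempty {z | ends z = s(p, q)} with h | ⟨z₀, hz₀⟩
    · rw [h, ncard_empty]
      exact Nat.zero_le _
    replace hz₀ : ends z₀ = s(p, q) := hz₀
    have ht := hR.one_le_longestTwoPath z₀.2.1 z₀.2.2
    have hinr : ∀ j b, Sum.inr (j, b) ∈ s(p, q) →
        {z | ends z = s(p, q)}.ncard ≤ G.longestTwoPath := fun j b hj =>
      (hone j _ fun z (hz : ends z = s(p, q)) => hdummy z j b (hz ▸ hj)).trans ht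
    rcases p with f | ⟨j, b⟩
    · rcases q with f' | ⟨j, b⟩
      · obtain ⟨e, he, hze⟩ := hR.exists_edge_mem z₀.2.1 z₀.2.2
        -- Parallel dual edges between two genuine faces all lie on the one edge `e` of `R` shared
        -- by these faces.
        refine (hcard (fun z => z ∈ e) _ fun z (hz : ends z = s(_, _)) => ?_).trans (hR.ncard_le_longestTwoPath he)
        obtain ⟨e', he', hze'⟩ := hR.exists_edge_mem z.2.1 z.2.2
        have hff' : f ≠ f' := by
          rintro rfl
          exact hloop z₀ (by rw [hz₀]; simp)
        have h1 := (hface z f).1 (hz ▸ Sym2.mem_mk_left _ _)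
        have h2 := (hface z f').1 (hz ▸ Sym2.mem_mk_right _ _)
        have h3 := (hface z₀ f).1 (hz₀ ▸ Sym2.mem_mk_left _ _)
        have h4 := (hface z₀ f').1 (hz₀ ▸ Sym2.mem_mk_right _ _)
        rw [eq_of_mem_frontier_two hconn he he' h1.1 h2.1 hff' hze z₀.2.2 hze' z.2.2 h3.2 h4.2
          h1.2 h2.2]
        exact hze'
      · exact hinr j b (Sym2.mem_mk_right _ _)
    · exact hinr j b (Sym2.mem_mk_left _ _)

/-- Subdividing leaves the faces unchanged, and disjoint palettes exclude conflicts between old and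
new vertices. -/
theorem Refines.cyclicChromaticNumber_le (hR : Refines R G) (hsimple : R.IsSimple)
    (hconn : R.IsThreeConnected) : G.cyclicChromaticNumber ≤
      R.cyclicChromaticNumber + (G.maxFaceDegree - 3 + G.longestTwoPath) := by
  classical
  obtain ⟨c₁, hc₁⟩ := R.exists_isCyclicColoring
  obtain ⟨c₂, hc₂⟩ := hR.exists_coloring_new hsimple hconn
  refine Nat.sInf_le ⟨fun z => finSumFinEquiv (if h : (z : Plane) ∈ R.verts then
    .inl (c₁ ⟨z, h⟩) else .inr (c₂ ⟨z, z.2, h⟩)), ?_⟩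
  intro f hf u v hu hv huv h
  rw [hR.faces_eq] at hf
  replace h := finSumFinEquiv.injective h
  by_cases h1 : (u : Plane) ∈ R.verts <;> by_cases h2 : (v : Plane) ∈ R.verts
  · simp only [h1, h2, dite_true, Sum.inl.injEq] at h
    exact hc₁ f hf ⟨u, h1⟩ ⟨v, h2⟩ ⟨h1, hu.2⟩ ⟨h2, hv.2⟩
      (fun h' => huv (Subtype.ext (by simpa using h'))) h
  · simp [h1, h2] at h
  · simp [h1, h2] at h
  · simp only [h1, h2, dite_false, Sum.inr.injEq] at h
    exact hc₂ f hf ⟨u, u.2, h1⟩ ⟨v, v.2, h2⟩ hu.2 hv.2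
      (fun h' => huv (Subtype.ext (by simpa using h'))) h

end PlaneGraph

end

/-- Here `3 * G.maxFaceDegree / 2` is division of natural numbers, rounded down. -/
theorem corollary2 (R G : PlaneGraph) (hsimple : R.IsSimple) (hconn : R.IsThreeConnected)
    (hsub : R.IsSubdivision G)
    (hdeg : (G.maxFaceDegree : ℤ) ≥
      2 * (R.cyclicChromaticNumber : ℤ) + 2 * (G.longestTwoPath : ℤ) - 6) :
    G.cyclicChromaticNumber ≤ 3 * G.maxFaceDegree / 2 := by
  have hR := hsub.refines
  obtain ⟨f, hf⟩ := R.exists_face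
  -- Any face serves here: it shows that Δ* is at least 3, so the subtraction in `h2` is not
  -- truncated.
  have h1 := hR.ncard_new_add_three_le hsimple hconn.1 hf
  have h2 := hR.cyclicChromaticNumber_le hsimple hconn
  omega
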